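/- Let $R$ be an associative ring with $1$, let $\delta\colon R\to R$ be a derivation (additive, $\delta(rs)=\delta(r)s+r\delta(s)$), let $M$ be a right $R$-module, and let $d\colon M\to M$ be a $\delta$-derivation (additive, $d(xr)=d(x)r+x\delta(r)$). A hereditary torsion theory for right $R$-modules is identified with its Gabriel filter $\mathfrak F$ of right ideals; its torsion submodule is $t(M)=\{m\in M : \mathrm{ann}_r(m)\in\mathfrak F\}$, and it is faithful if $t(R)=0$. It is differential if for every derivation $\partial$ of $R$ and every $I\in\mathfrak F$ there is $J\in\mathfrak F$ with $\partial(J)\subseteq I$. The module of quotients is $M_{\mathfrak F}=\varinjlim_{I\in\mathfrak F}\mathrm{Hom}_R(I,M/t(M))$, with canonical map $q\colon M\to M_{\mathfrak F}$; $R_{\mathfrak F}$ is a ring, the right ring of quotients, and $M_{\mathfrak F}$ is a right $R_{\mathfrak F}$-module. If $\mathfrak F_1\subseteq\mathfrak F_2$, there is a canonical map $q_{12}\colon M_{\mathfrak F_1}\to M_{\mathfrak F_2}$ with $q_{12}q_1=q_2$. An extension of $d$ to $M_{\mathfrak F}$ is a $\delta$-derivation $D$ of $M_{\mathfrak F}$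 with $Dq=qd$; an extension of $\delta$ to the ring $R_{\mathfrak F}$ is a derivation $D$ of the ring $R_{\mathfrak F}$ with $Dq=q\delta$. We say that the extensions with respect to $\mathfrak F_1$ and $\mathfrak F_2$ agree if $\mathfrak F_1\subseteq\mathfrak F_2$, there are unique extensions $D_1$ and $D_2$ with respect to $\mathfrak F_1$ and $\mathfrak F_2$, and $q_{12}D_1=D_2q_{12}$. The Lambek torsion theory is the one whose Gabriel filter consists of the dense right ideals; its right ring of quotients is $Q_{\max}(R)$. The Goldie torsion theory is the one whose torsion-free modules are the nonsingular modules (its filter is the smallest Gabriel filter containing all essential right ideals); its right ring of quotients is $Q_{\mathrm{Gold}}(R)$. A filter $\mathfrak F$ is perfect if the canonical map $N\otimes_R R_{\mathfrak F}\to N_{\mathfrak F}$ is bijective for every right $R$-module $N$; the maximal perfect torsion theory is given by the largest faithful perfect filter, and its right ring of quotients is the total right ring of quotients $Q_{\mathrm{tot}}(R)$. $R$ is right Ore if $rT\cap tR\neq\emptyset$ for all $r\in R$ and $t\in T$, where $T$ is the set of regular elements; the classical torsion theory is then the one in which a module is torsion iff each of its elements is annihilated by some $t\in T$, and its right ring of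 quotients is $Q_{\mathrm{cl}}(R)$. Then: 1. The extension of $\delta$ to any right ring of quotients with respect to a hereditary and faithful torsion theory agrees with the extension of $\delta$ to $Q_{\max}(R)$. In particular, the extensions to $Q_{\mathrm{tot}}(R)$ and $Q_{\max}(R)$ agree. 2. The extension of $d$ to any module of quotients of $M$ with respect to a differential, hereditary and faithful torsion theory agrees with the extension of $d$ to the module of quotients with respect to the Lambek torsion theory. In particular, the extensions of $d$ to the modules of quotients of $M$ with respect to the maximal perfect and the Lambek torsion theory agree. 3. If $R$ is right Ore, then the extension of $\delta$ to $Q_{\mathrm{cl}}(R)$ agrees with the extension to $Q_{\max}(R)$ and with the extension to $Q_{\mathrm{tot}}(R)$. 4. The extensions of $\delta$ to $Q_{\max}(R)$ and $Q_{\mathrm{Gold}}(R)$ agree. Moreover, the extension of $\delta$ to any right ring of quotients with respect to a hereditary and faithful torsion theory agrees with the extension of $\delta$ to $Q_{\mathrm{Gold}}(R)$. -/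

import Mathlib

open MulOpposite TensorProduct

universe u v w

/-! Right `R`-modules are modules over `Rᵐᵒᵖ`, with `op r • m` for `m r`; right ideals of `R` are
the `Rᵐᵒᵖ`-submodules of `R`. -/

/-- A derivation of a (not necessarily commutative) ring. -/
structure IsRingDerivation {R : Type u} [Ring R] (δ : R → R) : Prop where
  map_add : ∀ r s, δ (r + s) = δ r + δ s
  map_mul : ∀ r s, δ (r * s) = δ r * s + r * δ s

/-- A `δ`-derivation of a right `R`-module: `d (x r) = d (x) r + x δ(r)`. -/
structure IsModuleDerivation {R : Type u} [Ring R] {M : Type v} [AddCommGroup M] [Module Rᵐᵒᵖ M]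
    (δ : R → R) (d : M → M) : Prop where
  map_add : ∀ x y, d (x + y) = d x + d y
  map_smul : ∀ (x : M) (r : R), d (op r • x) = op r • d x + op (δ r) • x

/-- Left multiplication `L_m : R → M`, `r ↦ m r`, as a map of right modules. -/
def leftMulMap {R : Type u} [Ring R] {M : Type v} [AddCommGroup M] [Module Rᵐᵒᵖ M] (m : M) :
    R →ₗ[Rᵐᵒᵖ] M where
  toFun r := op r • m
  map_add' r s := by rw [op_add, add_smul]
  map_smul' c r := by
    rw [show (c • r : R) = r * unop c from rfl, op_mul, op_unop, mul_smul]; rfl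

@[simp] theorem leftMulMap_apply {R : Type u} [Ring R] {M : Type v} [AddCommGroup M]
    [Module Rᵐᵒᵖ M] (m : M) (r : R) : leftMulMap m r = op r • m := rfl

/-- The right annihilator `{r | m r = 0}` of an element. -/
def rightAnn {R : Type u} [Ring R] {M : Type v} [AddCommGroup M] [Module Rᵐᵒᵖ M] (m : M) :
    Submodule Rᵐᵒᵖ R :=
  LinearMap.ker (leftMulMap m)

/-- The right ideal `(I : a) = {r | a r ∈ I}`. -/
def rightColon {R : Type u} [Ring R] (I : Submodule Rᵐᵒᵖ R) (a : R) : Submodule Rᵐᵒᵖ R :=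
  I.comap (leftMulMap a)

@[simp] theorem mem_rightAnn {R : Type u} [Ring R] {M : Type v} [AddCommGroup M] [Module Rᵐᵒᵖ M]
    {m : M} {r : R} : r ∈ rightAnn m ↔ op r • m = 0 := Iff.rfl

@[simp] theorem mem_rightColon {R : Type u} [Ring R] {I : Submodule Rᵐᵒᵖ R} {a r : R} :
    r ∈ rightColon I a ↔ a * r ∈ I := Iff.rfl

theorem rightIdeal_mul_mem {R : Type u} [Ring R] {I : Submodule Rᵐᵒᵖ R} {a : R} (h : a ∈ I)
    (r : R) : a * r ∈ I := I.smul_mem (op r) h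

/-- A (right) Gabriel filter on `R`. -/
@[ext]
structure GabrielFilter (R : Type u) [Ring R] where
  sets : Set (Submodule Rᵐᵒᵖ R)
  top_mem : ⊤ ∈ sets
  mem_of_le : ∀ {I J : Submodule Rᵐᵒᵖ R}, I ∈ sets → I ≤ J → J ∈ sets
  inf_mem : ∀ {I J : Submodule Rᵐᵒᵖ R}, I ∈ sets → J ∈ sets → I ⊓ J ∈ sets
  colon_mem : ∀ {I : Submodule Rᵐᵒᵖ R}, I ∈ sets → ∀ a : R, rightColon I a ∈ sets
  mem_of_colon : ∀ {I J : Submodule Rᵐᵒᵖ R}, I ∈ sets → (∀ a ∈ I, rightColon J a ∈ sets) → J ∈ sets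

namespace GabrielFilter

section Basic

variable {R : Type u} [Ring R]

/-- Gabriel filters are ordered by inclusion. -/
instance : PartialOrder (GabrielFilter R) where
  le F G := F.sets ⊆ G.sets
  le_refl _ := subset_refl _
  le_trans _ _ _ h h' := Set.Subset.trans h h'
  le_antisymm _ _ h h' := GabrielFilter.ext (Set.Subset.antisymm h h')

/-- The intersection of a set of Gabriel filters. -/
def inter (S : Set (GabrielFilter R)) : GabrielFilter R where
  sets := {I | ∀ F ∈ S, I ∈ F.sets}
  top_mem F _ := F.top_mem
  mem_of_le h hle F hF := F.mem_of_le (h F hF) hle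
  inf_mem h h' F hF := F.inf_mem (h F hF) (h' F hF)
  colon_mem h a F hF := F.colon_mem (h F hF) a
  mem_of_colon h h' F hF := F.mem_of_colon (h F hF) fun a ha => h' a ha F hF

/-- The join of a set of Gabriel filters: the smallest one which contains all of them. -/
def join (S : Set (GabrielFilter R)) : GabrielFilter R := inter (upperBounds S)

theorem isLUB_join (S : Set (GabrielFilter R)) : IsLUB S (join S) :=
  ⟨fun _ hF _ hI _ hG => hG hF hI, fun G hG _ hI => hI G hG⟩

/-- The torsion submodule `t(M)`: the elements whose right annihilator is in the filter. -/
def torsion (F : GabrielFilter R) (M : Type v) [AddCommGroup M] [Module Rᵐᵒᵖ M] :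
    Submodule Rᵐᵒᵖ M where
  carrier := {m | rightAnn m ∈ F.sets}
  zero_mem' := F.mem_of_le F.top_mem fun r _ => by simp
  add_mem' {a b} ha hb := F.mem_of_le (F.inf_mem ha hb) fun r hr => by
    have h1 : op r • a = 0 := hr.1
    have h2 : op r • b = 0 := hr.2
    simp [smul_add, h1, h2]
  smul_mem' c m hm := F.mem_of_le (F.colon_mem hm (unop c)) fun r hr => by
    have h1 : op (unop c * r) • m = 0 := hr
    rw [op_mul, op_unop, mul_smul] at h1
    exact h1

theorem mem_torsion {F : GabrielFilter R} {M : Type v} [AddCommGroup M] [Module Rᵐᵒᵖ M] {m : M} :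
    m ∈ F.torsion M ↔ rightAnn m ∈ F.sets := Iff.rfl

/-- The torsion theory of `F` is faithful: `t(R) = 0`. -/
def IsFaithful (F : GabrielFilter R) : Prop := F.torsion R = ⊥

/-- `F` is differential: for every derivation `δ` and every `I ∈ F` there is `J ∈ F` with
`δ(J) ⊆ I`. -/
def IsDifferential (F : GabrielFilter R) : Prop :=
  ∀ δ : R → R, IsRingDerivation δ → ∀ I ∈ F.sets, ∃ J ∈ F.sets, ∀ r ∈ J, δ r ∈ I

/-- `M / t(M)` is torsion-free. -/
theorem eq_zero_of_rightAnn_mem (F : GabrielFilter R) {M : Type v} [AddCommGroup M]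
    [Module Rᵐᵒᵖ M] {y : M ⧸ F.torsion M} (h : rightAnn y ∈ F.sets) : y = 0 := by
  obtain ⟨m, rfl⟩ := Submodule.mkQ_surjective _ y
  rw [Submodule.mkQ_apply, Submodule.Quotient.mk_eq_zero, mem_torsion]
  refine F.mem_of_colon h fun a ha => ?_
  have ha' : op a • m ∈ F.torsion M := by
    rw [← Submodule.Quotient.mk_eq_zero, Submodule.Quotient.mk_smul]
    exact ha
  refine F.mem_of_le (mem_torsion.1 ha') fun r hr => ?_
  have h1 : op r • op a • m = 0 := hr
  rw [← mul_smul, ← op_mul] at h1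
  exact h1

end Basic

/-! ### Modules of quotients -/

section Quotients

variable {R : Type u} [Ring R] (F : GabrielFilter R)
variable (M : Type v) [AddCommGroup M] [Module Rᵐᵒᵖ M]

/-- Homomorphisms of right modules `I → M / t(M)` with `I ∈ F`. -/
def PreQuot : Type (max u v) := {f : R →ₗ.[Rᵐᵒᵖ] (M ⧸ F.torsion M) // f.domain ∈ F.sets}

variable {M}

/-- `f` is defined at `x` and has the value `y` there. -/
def Val {N : Type w} [AddCommGroup N] [Module Rᵐᵒᵖ N] (f : R →ₗ.[Rᵐᵒᵖ] N) (x : R) (y : N) : Prop :=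
  ∃ h : x ∈ f.domain, f ⟨x, h⟩ = y

section Val

variable {N : Type w} [AddCommGroup N] [Module Rᵐᵒᵖ N] {f g : R →ₗ.[Rᵐᵒᵖ] N} {x x' : R} {y y' : N}

theorem Val.unique (h : Val f x y) (h' : Val f x y') : y = y' := by
  obtain ⟨_, rfl⟩ := h
  obtain ⟨_, rfl⟩ := h'
  rfl

theorem Val.add (h : Val f x y) (h' : Val f x' y') : Val f (x + x') (y + y') := by
  obtain ⟨h1, rfl⟩ := h
  obtain ⟨h2, rfl⟩ := h'
  exact ⟨add_mem h1 h2, f.map_add ⟨x, h1⟩ ⟨x', h2⟩⟩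

theorem Val.smul (h : Val f x y) (c : Rᵐᵒᵖ) : Val f (c • x) (c • y) := by
  obtain ⟨h1, rfl⟩ := h
  exact ⟨Submodule.smul_mem _ c h1, f.map_smul c ⟨x, h1⟩⟩

theorem Val.pAdd (h : Val f x y) (h' : Val g x y') : Val (f + g) x (y + y') := by
  obtain ⟨h1, rfl⟩ := h
  obtain ⟨h2, rfl⟩ := h'
  exact ⟨⟨h1, h2⟩, rfl⟩

theorem Val.pNeg (h : Val f x y) : Val (-f) x (-y) := by
  obtain ⟨h1, rfl⟩ := h
  exact ⟨h1, rfl⟩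

theorem val_zero (x : R) : Val (0 : R →ₗ.[Rᵐᵒᵖ] N) x 0 := ⟨trivial, rfl⟩

theorem val_of_mem (h : x ∈ f.domain) : Val f x (f ⟨x, h⟩) := ⟨h, rfl⟩

end Val

/-- Two homomorphisms `I → M / t(M)` and `J → M / t(M)` represent the same element of the direct
limit iff they agree on some `K ∈ F` (equivalently, if their equalizer is in `F`). -/
instance preQuotSetoid : Setoid (F.PreQuot M) where
  r f g := f.1.eqLocus g.1 ∈ F.sets
  iseqv :=
    { refl := fun f => F.mem_of_le f.2 fun _ hx => ⟨hx, hx, rfl⟩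
      symm := fun h => F.mem_of_le h fun _ ⟨h1, h2, h3⟩ => ⟨h2, h1, h3.symm⟩
      trans := fun h h' => F.mem_of_le (F.inf_mem h h')
        fun _ ⟨⟨h1, _, h3⟩, ⟨_, h5, h6⟩⟩ => ⟨h1, h5, h3.trans h6⟩ }

variable (M) in
/-- The module of quotients `M_F`, the direct limit of `Hom(I, M / t(M))` over `I ∈ F`. -/
def Quotients : Type (max u v) := Quotient (F.preQuotSetoid (M := M))

variable {F}

theorem quot_eq {f g : F.PreQuot M} {K : Submodule Rᵐᵒᵖ R} (hK : K ∈ F.sets)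
    (h : ∀ x ∈ K, ∃ y, Val f.1 x y ∧ Val g.1 x y) :
    (Quotient.mk _ f : F.Quotients M) = Quotient.mk _ g :=
  Quotient.sound (F.mem_of_le hK fun x hx => by
    obtain ⟨y, ⟨h1, h2⟩, ⟨h3, h4⟩⟩ := h x hx
    exact ⟨h1, h3, h2.trans h4.symm⟩)

theorem exists_of_rel {f g : F.PreQuot M} (h : f ≈ g) :
    ∃ K ∈ F.sets, ∀ x ∈ K, ∃ y, Val f.1 x y ∧ Val g.1 x y :=
  ⟨_, h, fun _ ⟨h1, h2, h3⟩ => ⟨_, ⟨h1, rfl⟩, ⟨h2, h3.symm⟩⟩⟩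

/-- Addition of representatives: `f + g` on the intersection of the domains. -/
def preAdd (f g : F.PreQuot M) : F.PreQuot M := ⟨f.1 + g.1, F.inf_mem f.2 g.2⟩

/-- Negation of representatives. -/
def preNeg (f : F.PreQuot M) : F.PreQuot M := ⟨-f.1, f.2⟩

instance : Zero (F.Quotients M) := ⟨Quotient.mk _ ⟨0, F.top_mem⟩⟩

instance : Add (F.Quotients M) where
  add := Quotient.map₂ preAdd fun f f' h g g' h' => by
    obtain ⟨K, hK, hf⟩ := exists_of_rel h
    obtain ⟨L, hL, hg⟩ := exists_of_rel h'
    refine Quotient.exact (quot_eq (F.inf_mem hK hL) fun x hx => ?_)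
    obtain ⟨y, h1, h2⟩ := hf x hx.1
    obtain ⟨z, h3, h4⟩ := hg x hx.2
    exact ⟨y + z, h1.pAdd h3, h2.pAdd h4⟩

instance : Neg (F.Quotients M) where
  neg := Quotient.map preNeg fun f f' h => by
    obtain ⟨K, hK, hf⟩ := exists_of_rel h
    refine Quotient.exact (quot_eq hK fun x hx => ?_)
    obtain ⟨y, h1, h2⟩ := hf x hx
    exact ⟨-y, h1.pNeg, h2.pNeg⟩

/-- The pointwise additive group structure of the direct limit. -/
instance : AddCommGroup (F.Quotients M) where
  add_assoc a b c := by
    induction a using Quotient.inductionOn with | _ f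
    induction b using Quotient.inductionOn with | _ g
    induction c using Quotient.inductionOn with | _ k
    exact congrArg (Quotient.mk _) (Subtype.ext (add_assoc f.1 g.1 k.1))
  add_comm a b := by
    induction a using Quotient.inductionOn with | _ f
    induction b using Quotient.inductionOn with | _ g
    exact congrArg (Quotient.mk _) (Subtype.ext (add_comm f.1 g.1))
  zero_add a := by
    induction a using Quotient.inductionOn with | _ f
    exact congrArg (Quotient.mk _) (Subtype.ext (zero_add f.1))
  add_zero a := by
    induction a using Quotient.inductionOn with | _ f
    exact congrArg (Quotient.mk _) (Subtype.ext (add_zero f.1))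
  neg_add_cancel a := by
    induction a using Quotient.inductionOn with | _ f
    refine quot_eq f.2 fun x hx => ⟨0, ?_, val_zero x⟩
    have h := (val_of_mem hx).pNeg.pAdd (val_of_mem hx)
    rw [neg_add_cancel] at h
    exact h
  nsmul := nsmulRec
  zsmul := zsmulRec

/-- For `L ∈ F` and `g : J → M / t(M)`, the elements `x ∈ J` such that `g x` is the class of
an element of the submodule `P`. -/
def preim (g : R →ₗ.[Rᵐᵒᵖ] (M ⧸ F.torsion M)) (P : Submodule Rᵐᵒᵖ M) : Submodule Rᵐᵒᵖ R where
  carrier := {x | ∃ y ∈ P, Val g x ((F.torsion M).mkQ y)}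
  zero_mem' := ⟨0, P.zero_mem, by
    rw [map_zero]; exact ⟨zero_mem _, g.map_zero⟩⟩
  add_mem' := fun ⟨y, hy, h⟩ ⟨z, hz, h'⟩ => ⟨y + z, P.add_mem hy hz, by
    rw [_root_.map_add]; exact h.add h'⟩
  smul_mem' c x := fun ⟨y, hy, h⟩ => ⟨c • y, P.smul_mem c hy, by
    rw [_root_.map_smul]; exact h.smul c⟩

theorem preim_mem {g : R →ₗ.[Rᵐᵒᵖ] (R ⧸ F.torsion R)} (hg : g.domain ∈ F.sets)
    {L : Submodule Rᵐᵒᵖ R} (hL : L ∈ F.sets) : preim g L ∈ F.sets := by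
  refine F.mem_of_colon hg fun x hx => ?_
  obtain ⟨r, hr⟩ := Submodule.mkQ_surjective _ (g ⟨x, hx⟩)
  refine F.mem_of_le (F.colon_mem hL r) fun s hs => ⟨r * s, hs, ?_⟩
  have h := (show Val g x _ from ⟨hx, hr.symm⟩).smul (op s)
  rw [← _root_.map_smul] at h
  exact h

/-- A map from a right ideal in `F` to a torsion-free module kills torsion. -/
theorem val_congr {f : R →ₗ.[Rᵐᵒᵖ] (M ⧸ F.torsion M)} {a b : R} {y z : M ⧸ F.torsion M}
    (ha : Val f a y) (hb : Val f b z)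
    (hab : (F.torsion R).mkQ a = (F.torsion R).mkQ b) : y = z := by
  have h1 : a - b ∈ F.torsion R := (Submodule.Quotient.eq _).1 hab
  refine sub_eq_zero.1 (F.eq_zero_of_rightAnn_mem (F.mem_of_le (mem_torsion.1 h1) fun r hr => ?_))
  have h2 : Val f (a - b) (y - z) := by
    have h3 := ha.add (hb.smul (-1))
    rwa [neg_smul, one_smul, neg_smul, one_smul, ← sub_eq_add_neg, ← sub_eq_add_neg] at h3
  have h4 := h2.smul (op r)
  have h5 : op r • (a - b) = 0 := hr
  rw [h5] at h4
  exact h4.unique ⟨zero_mem _, f.map_zero⟩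

/-- The composite of `g : J → R / t(R)` with the map `(I + t(R)) / t(R) → M / t(M)` which is
induced by `f : I → M / t(M)`, defined on all `x ∈ J` with `g x ∈ (I + t(R)) / t(R)`. -/
noncomputable def pComp (f : R →ₗ.[Rᵐᵒᵖ] (M ⧸ F.torsion M)) (g : R →ₗ.[Rᵐᵒᵖ] (R ⧸ F.torsion R)) :
    R →ₗ.[Rᵐᵒᵖ] (M ⧸ F.torsion M) where
  domain := preim g f.domain
  toFun :=
    { toFun := fun x => f ⟨x.2.choose, x.2.choose_spec.1⟩
      map_add' := fun x y => by
        refine val_congr (val_of_mem _) ((val_of_mem x.2.choose_spec.1).add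
          (val_of_mem y.2.choose_spec.1)) ?_
        rw [_root_.map_add]
        exact (x + y).2.choose_spec.2.unique (x.2.choose_spec.2.add y.2.choose_spec.2)
      map_smul' := fun c x => by
        refine val_congr (val_of_mem _) ((val_of_mem x.2.choose_spec.1).smul c) ?_
        rw [_root_.map_smul]
        exact (c • x).2.choose_spec.2.unique (x.2.choose_spec.2.smul c) }

theorem Val.pComp {f : R →ₗ.[Rᵐᵒᵖ] (M ⧸ F.torsion M)} {g : R →ₗ.[Rᵐᵒᵖ] (R ⧸ F.torsion R)}
    {x y : R} {z : M ⧸ F.torsion M} (h : Val g x ((F.torsion R).mkQ y)) (h' : Val f y z) :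
    Val (pComp f g) x z := by
  have hx : x ∈ preim g f.domain := ⟨y, h'.1, h⟩
  refine ⟨hx, val_congr (val_of_mem hx.choose_spec.1) h' ?_⟩
  exact hx.choose_spec.2.unique h

/-- Composition of representatives. -/
noncomputable def preComp (f : F.PreQuot M) (g : F.PreQuot R) : F.PreQuot M :=
  ⟨GabrielFilter.pComp f.1 g.1, preim_mem g.2 f.2⟩

/-- The right action `M_F × R_F → M_F`; for `M = R` it is the multiplication of `R_F`. -/
noncomputable def act : F.Quotients M → F.Quotients R → F.Quotients M :=
  Quotient.map₂ preComp fun f f' h g g' h' => by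
    obtain ⟨K, hK, hg⟩ := exists_of_rel h'
    refine Quotient.exact (quot_eq (F.inf_mem hK (preim_mem g.2 h)) fun x hx => ?_)
    obtain ⟨y, ⟨h1, h2, h3⟩, h4⟩ := hx.2
    obtain ⟨z, h5, h6⟩ := hg x hx.1
    obtain rfl := h4.unique h5
    exact ⟨_, h4.pComp ⟨h1, rfl⟩, h6.pComp ⟨h2, h3.symm⟩⟩

/-- The canonical map `q_M : M → M_F`, `m ↦ L_{m + t(M)}`. -/
def toQuot (F : GabrielFilter R) (m : M) : F.Quotients M :=
  Quotient.mk _ ⟨((F.torsion M).mkQ.comp (leftMulMap m)).toPMap ⊤, F.top_mem⟩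

theorem val_toQuot (F : GabrielFilter R) (m : M) (x : R) :
    Val (((F.torsion M).mkQ.comp (leftMulMap m)).toPMap ⊤) x ((F.torsion M).mkQ (op x • m)) :=
  ⟨trivial, rfl⟩

theorem toQuot_add (m n : M) : F.toQuot (m + n) = F.toQuot m + F.toQuot n :=
  quot_eq F.top_mem fun x _ => ⟨_, val_toQuot F (m + n) x, by
    rw [smul_add, _root_.map_add]
    exact (val_toQuot F m x).pAdd (val_toQuot F n x)⟩

theorem act_toQuot (m : M) (r : R) : act (F.toQuot m) (F.toQuot r) = F.toQuot (op r • m) :=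
  quot_eq F.top_mem fun x _ => ⟨_, (val_toQuot F r x).pComp (val_toQuot F m _), by
    rw [smul_eq_mul_unop, unop_op, op_mul, mul_smul]
    exact val_toQuot F (op r • m) x⟩

theorem act_one (a : F.Quotients M) : act a (F.toQuot (1 : R)) = a := by
  induction a using Quotient.inductionOn with | _ f
  refine quot_eq f.2 fun x hx => ⟨_, (val_toQuot F 1 x).pComp ?_, val_of_mem hx⟩
  rw [smul_eq_mul_unop, unop_op, one_mul]
  exact val_of_mem hx

theorem act_assoc (a : F.Quotients M) (b c : F.Quotients R) : act (act a b) c = act a (act b c) := by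
  induction a using Quotient.inductionOn with | _ f
  induction b using Quotient.inductionOn with | _ g
  induction c using Quotient.inductionOn with | _ k
  refine quot_eq (preim_mem k.2 (preim_mem g.2 f.2)) fun x hx => ?_
  obtain ⟨y, ⟨z, hz, hy⟩, h⟩ := hx
  exact ⟨_, h.pComp (hy.pComp (val_of_mem hz)), (h.pComp hy).pComp (val_of_mem hz)⟩

theorem add_act (a b : F.Quotients M) (c : F.Quotients R) : act (a + b) c = act a c + act b c := by
  induction a using Quotient.inductionOn with | _ f
  induction b using Quotient.inductionOn with | _ g
  induction c using Quotient.inductionOn with | _ k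
  refine quot_eq (preim_mem k.2 (F.inf_mem f.2 g.2)) fun x hx => ?_
  obtain ⟨y, hy, h⟩ := hx
  exact ⟨_, h.pComp ((val_of_mem hy.1).pAdd (val_of_mem hy.2)),
    (h.pComp (val_of_mem hy.1)).pAdd (h.pComp (val_of_mem hy.2))⟩

theorem act_add (a : F.Quotients M) (b c : F.Quotients R) : act a (b + c) = act a b + act a c := by
  induction a using Quotient.inductionOn with | _ f
  induction b using Quotient.inductionOn with | _ g
  induction c using Quotient.inductionOn with | _ k
  refine quot_eq (F.inf_mem (preim_mem g.2 f.2) (preim_mem k.2 f.2)) fun x hx => ?_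
  obtain ⟨⟨y, hy, h⟩, ⟨z, hz, h'⟩⟩ := hx
  refine ⟨_, Val.pComp (y := y + z) ?_ ((val_of_mem hy).add (val_of_mem hz)),
    (h.pComp (val_of_mem hy)).pAdd (h'.pComp (val_of_mem hz))⟩
  rw [_root_.map_add]
  exact h.pAdd h'

/-- The right ring of quotients `R_F`. -/
noncomputable instance : Ring (F.Quotients R) where
  __ := (inferInstance : AddCommGroup (F.Quotients R))
  mul := act
  one := F.toQuot (1 : R)
  mul_assoc := act_assoc
  one_mul a := by
    change act _ a = a
    induction a using Quotient.inductionOn with | _ f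
    refine quot_eq f.2 fun x hx => ?_
    obtain ⟨y, hy⟩ := Submodule.mkQ_surjective _ (f.1 ⟨x, hx⟩)
    refine ⟨_, Val.pComp (y := y) ⟨hx, hy.symm⟩ (val_toQuot F 1 y), hx, ?_⟩
    rw [← hy, op_smul_eq_mul, one_mul]
  mul_one := act_one
  left_distrib := act_add
  right_distrib := add_act
  zero_mul a := by
    have h : act (0 : F.Quotients R) a = act 0 a + act 0 a := by rw [← add_act, add_zero]
    exact left_eq_add.1 h
  mul_zero a := by
    have h : act a 0 = act a 0 + act a 0 := by rw [← act_add, add_zero]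
    exact left_eq_add.1 h

theorem mul_def (a b : F.Quotients R) : a * b = act a b := rfl

theorem one_def : (1 : F.Quotients R) = F.toQuot (1 : R) := rfl

/-- `q_R` as a ring homomorphism `R → R_F`. -/
noncomputable def toQuotHom (F : GabrielFilter R) : R →+* F.Quotients R :=
  RingHom.mk' ⟨⟨F.toQuot, rfl⟩, fun r s => (act_toQuot r s).symm⟩ toQuot_add

/-- `M_F` is a right `R`-module through the right action of `R_F` and `q_R : R → R_F`. -/
noncomputable instance : Module Rᵐᵒᵖ (F.Quotients M) where
  smul c a := act a (F.toQuot (unop c))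
  one_smul a := act_one a
  mul_smul c c' a := by
    change act a (F.toQuot (unop (c * c'))) = act (act a _) _
    rw [act_assoc, ← mul_def]
    exact congrArg (act a) ((toQuotHom F).map_mul _ _)
  smul_zero c := by
    have h : act (0 : F.Quotients M) (F.toQuot (unop c)) =
        act 0 (F.toQuot (unop c)) + act 0 (F.toQuot (unop c)) := by
      rw [← add_act, add_zero]
    exact left_eq_add.1 h
  smul_add c a b := add_act a b _
  add_smul c c' a := by
    change act a (F.toQuot (unop c + unop c')) = act a _ + act a _
    rw [toQuot_add, act_add]
  zero_smul a := by
    change act a (F.toQuot 0) = 0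
    have h : act a (F.toQuot (0 : R)) = act a (F.toQuot 0) + act a (F.toQuot 0) := by
      rw [← act_add, ← toQuot_add, add_zero]
    exact left_eq_add.1 h

theorem op_smul_def (r : R) (a : F.Quotients M) : op r • a = act a (F.toQuot r) := rfl

theorem toQuot_smul (r : R) (m : M) : F.toQuot (op r • m) = op r • F.toQuot m :=
  (act_toQuot m r).symm

/-- On representatives, `(f r)(x) = f (r x)`. -/
theorem op_smul_mk_eq (r : R) (f g : F.PreQuot M)
    (h : ∀ x y, Val f.1 (r * x) y → Val g.1 x y) :
    op r • (show F.Quotients M from Quotient.mk _ f) = Quotient.mk _ g :=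
  quot_eq (F.colon_mem f.2 r) fun x hx => ⟨_, (val_toQuot F r x).pComp (val_of_mem hx),
    h x _ (val_of_mem hx)⟩

/-- The kernel of `q_M` is `t(M)`. -/
theorem toQuot_eq_zero_iff {m : M} : F.toQuot m = 0 ↔ m ∈ F.torsion M := by
  constructor
  · intro h
    obtain ⟨K, hK, h1⟩ := exists_of_rel (Quotient.exact h)
    rw [← Submodule.Quotient.mk_eq_zero]
    refine F.eq_zero_of_rightAnn_mem (F.mem_of_le hK fun x hx => ?_)
    obtain ⟨y, h2, h3⟩ := h1 x hx
    obtain rfl := h3.unique (val_zero x)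
    exact (val_toQuot F m x).unique h2
  · intro h
    refine quot_eq F.top_mem fun x _ => ⟨_, val_toQuot F m x, ?_⟩
    rw [_root_.map_smul, Submodule.mkQ_apply, (Submodule.Quotient.mk_eq_zero _).2 h, smul_zero]
    exact val_zero x

theorem torsion_mono {F G : GabrielFilter R} (h : F ≤ G) : F.torsion M ≤ G.torsion M :=
  fun _ hm => h hm

/-- The canonical map `q₁₂ : M_F → M_G` for `F ⊆ G`: compose `I → M / t_F(M)` with the projection
`M / t_F(M) → M / t_G(M)`. -/
def quotMap {F G : GabrielFilter R} (h : F ≤ G) : F.Quotients M → G.Quotients M :=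
  Quotient.map (fun f => ⟨(Submodule.factor (torsion_mono h)).compPMap f.1, h f.2⟩)
    fun f f' hf => by
      obtain ⟨K, hK, h1⟩ := exists_of_rel hf
      refine Quotient.exact (quot_eq (h hK) fun x hx => ?_)
      obtain ⟨y, ⟨h2, h3⟩, ⟨h4, h5⟩⟩ := h1 x hx
      exact ⟨Submodule.factor (torsion_mono h) y, ⟨h2, congrArg _ h3⟩, ⟨h4, congrArg _ h5⟩⟩

/-- `q₁₂ ∘ q₁ = q₂`. -/
theorem quotMap_toQuot {F G : GabrielFilter R} (h : F ≤ G) (m : M) :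
    quotMap h (F.toQuot m) = G.toQuot m := rfl

end Quotients

/-! ### Perfect filters -/

section Perfect

variable {R : Type u} [Ring R] (F : GabrielFilter R)
variable (M : Type v) [AddCommGroup M] [Module Rᵐᵒᵖ M]

/-- The relations `m r ⊗ x = m ⊗ r x` which define `M ⊗_R R_F`. -/
noncomputable def tensorRel : AddSubgroup (M ⊗[ℤ] F.Quotients R) :=
  AddSubgroup.closure {z | ∃ (m : M) (r : R) (x : F.Quotients R),
    z = (op r • m) ⊗ₜ[ℤ] x - m ⊗ₜ[ℤ] (F.toQuot r * x)}

/-- The tensor product `M ⊗_R R_F` over the noncommutative ring `R`. -/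
noncomputable abbrev TensorQuotients : Type (max u v) := (M ⊗[ℤ] F.Quotients R) ⧸ F.tensorRel M

/-- The additive map `M ⊗_ℤ R_F → M_F`, `m ⊗ x ↦ q_M(m) x`. -/
noncomputable def tensorIntMap : M ⊗[ℤ] F.Quotients R →+ F.Quotients M :=
  TensorProduct.liftAddHom
    (AddMonoidHom.mk' (fun m => AddMonoidHom.mk' (fun x => act (F.toQuot m) x)
      fun x y => act_add _ x y)
      fun m n => by
        ext x
        exact (congrArg (fun y => act y x) (toQuot_add m n)).trans (add_act _ _ x))
    (fun k m x => by
      rw [_root_.map_zsmul, _root_.map_zsmul]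
      rfl)

@[simp] theorem tensorIntMap_tmul (m : M) (x : F.Quotients R) :
    F.tensorIntMap M (m ⊗ₜ[ℤ] x) = act (F.toQuot m) x := rfl

theorem tensorRel_le_ker : F.tensorRel M ≤ (F.tensorIntMap M).ker := by
  refine (AddSubgroup.closure_le _).2 ?_
  rintro _ ⟨m, r, x, rfl⟩
  change F.tensorIntMap M _ = 0
  rw [_root_.map_sub, tensorIntMap_tmul, tensorIntMap_tmul, mul_def, ← act_assoc, act_toQuot,
    sub_self]

/-- The canonical map `M ⊗_R R_F → M_F`, `m ⊗ x ↦ q_M(m) x`. -/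
noncomputable def tensorMap : F.TensorQuotients M →+ F.Quotients M :=
  QuotientAddGroup.lift _ (F.tensorIntMap M) (F.tensorRel_le_ker M)

/-- `F` is perfect: `M ⊗_R R_F ≅ M_F` canonically, for every right `R`-module `M`. -/
def IsPerfect : Prop :=
  ∀ (M : Type u) [AddCommGroup M] [Module Rᵐᵒᵖ M], Function.Bijective (F.tensorMap M)

end Perfect

section PerfectCriterion

variable {R : Type u} [Ring R] {F G : GabrielFilter R}

theorem quotMap_add {M : Type v} [AddCommGroup M] [Module Rᵐᵒᵖ M] (h : F ≤ G)
    (x y : F.Quotients M) : quotMap h (x + y) = quotMap h x + quotMap h y := by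
  induction x using Quotient.inductionOn with | _ f
  induction y using Quotient.inductionOn with | _ g
  refine quot_eq (h (F.inf_mem f.2 g.2)) fun z hz => ⟨_, val_of_mem hz, hz, ?_⟩
  exact (_root_.map_add (Submodule.factor (torsion_mono h)) (f.1 ⟨z, hz.1⟩) (g.1 ⟨z, hz.2⟩)).symm

theorem Val.factor {M : Type v} [AddCommGroup M] [Module Rᵐᵒᵖ M] (h : F ≤ G)
    {f : R →ₗ.[Rᵐᵒᵖ] (M ⧸ F.torsion M)} {x : R} {y : M ⧸ F.torsion M} (hf : Val f x y) :
    Val ((Submodule.factor (torsion_mono h)).compPMap f) x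
      (Submodule.factor (torsion_mono h) y) := by
  obtain ⟨h1, rfl⟩ := hf
  exact ⟨h1, rfl⟩

theorem quotMap_act {M : Type v} [AddCommGroup M] [Module Rᵐᵒᵖ M] (h : F ≤ G)
    (x : F.Quotients M) (y : F.Quotients R) :
    quotMap h (act x y) = act (quotMap h x) (quotMap h y) := by
  induction x using Quotient.inductionOn with | _ f
  induction y using Quotient.inductionOn with | _ g
  refine quot_eq (h (preim_mem g.2 f.2)) fun z hz => ?_
  obtain ⟨y, hy, hz⟩ := hz
  exact ⟨_, (hz.pComp (val_of_mem hy)).factor h, (hz.factor h).pComp ((val_of_mem hy).factor h)⟩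

/-- The extension `I R_F` of a right ideal `I` of `R` to `R_F` (without assuming `I ∈ F`). -/
noncomputable def extend (F : GabrielFilter R) (I : Submodule Rᵐᵒᵖ R) :
    Submodule (F.Quotients R)ᵐᵒᵖ (F.Quotients R) :=
  Submodule.span _ (F.toQuot '' I)

theorem extend_eq_top_of_one {I : Submodule Rᵐᵒᵖ R} (h : (1 : F.Quotients R) ∈ F.extend I)
    (x : F.Quotients R) : x ∈ F.extend I := by
  have h1 := rightIdeal_mul_mem h x
  rwa [one_mul] at h1

theorem toQuot_mem_extend {I : Submodule Rᵐᵒᵖ R} {a : R} (ha : a ∈ I) :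
    F.toQuot a ∈ F.extend I := Submodule.subset_span ⟨a, ha, rfl⟩

/-- Every element of `M_F` is carried into the image of `M` by some right ideal in `F`. -/
theorem exists_act_eq_toQuot {M : Type v} [AddCommGroup M] [Module Rᵐᵒᵖ M] (x : F.Quotients M) :
    ∃ I ∈ F.sets, ∀ a ∈ I, ∃ m : M, act x (F.toQuot a) = F.toQuot m := by
  induction x using Quotient.inductionOn with | _ f
  refine ⟨_, f.2, fun a ha => ?_⟩
  obtain ⟨m, hm⟩ := Submodule.mkQ_surjective _ (f.1 ⟨a, ha⟩)
  refine ⟨m, quot_eq F.top_mem fun z _ => ⟨_, ?_, val_toQuot F m z⟩⟩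
  refine (val_toQuot F a z).pComp ?_
  rw [_root_.map_smul, hm]
  exact (val_of_mem ha).smul (op z)

theorem IsPerfect.one_mem_extend (hF : F.IsPerfect) {I : Submodule Rᵐᵒᵖ R} (hI : I ∈ F.sets) :
    (1 : F.Quotients R) ∈ F.extend I := by
  let B := F.Quotients R ⧸ F.extend I
  let p : F.Quotients R →+ B := (F.extend I).mkQ.toAddMonoidHom
  have hp : ∀ x, p x = 0 ↔ x ∈ F.extend I := fun x => Submodule.Quotient.mk_eq_zero _
  let φ : R →+ (F.Quotients R →+ B) :=
    AddMonoidHom.mk' (fun r => p.comp (AddMonoidHom.mulLeft (F.toQuot r))) fun r s => by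
      ext x
      change p (F.toQuot (r + s) * x) = p (F.toQuot r * x) + p (F.toQuot s * x)
      rw [toQuot_add, add_mul, p.map_add]
  let ψ : (R ⧸ I) →+ (F.Quotients R →+ B) :=
    QuotientAddGroup.lift I.toAddSubgroup φ fun r hr => by
      change φ r = 0
      ext x
      exact (hp _).2 (rightIdeal_mul_mem (toQuot_mem_extend hr) x)
  let θ : (R ⧸ I) ⊗[ℤ] F.Quotients R →+ B := TensorProduct.liftAddHom ψ fun k m x => by
    rw [_root_.map_zsmul, _root_.map_zsmul]
    rfl
  have hθ : ∀ (r : R) (x : F.Quotients R),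
      θ ((Submodule.Quotient.mk r : R ⧸ I) ⊗ₜ[ℤ] x) = p (F.toQuot r * x) := fun _ _ => rfl
  have hrel : F.tensorRel (R ⧸ I) ≤ θ.ker := by
    refine (AddSubgroup.closure_le _).2 ?_
    rintro _ ⟨m, r, x, rfl⟩
    obtain ⟨s, rfl⟩ := Submodule.mkQ_surjective _ m
    change θ _ = 0
    rw [← _root_.map_smul, Submodule.mkQ_apply, Submodule.mkQ_apply, _root_.map_sub, hθ, hθ,
      toQuot_smul, op_smul_def, ← mul_def, mul_assoc, sub_self]
  have hker : F.tensorIntMap (R ⧸ I) ((Submodule.Quotient.mk 1 : R ⧸ I) ⊗ₜ[ℤ] 1) = 0 := by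
    rw [tensorIntMap_tmul, one_def, act_one, toQuot_eq_zero_iff, mem_torsion]
    refine F.mem_of_le hI fun r hr => ?_
    rw [mem_rightAnn, ← Submodule.Quotient.mk_smul, Submodule.Quotient.mk_eq_zero,
      op_smul_eq_mul, one_mul]
    exact hr
  have h1 : (QuotientAddGroup.mk ((Submodule.Quotient.mk 1 : R ⧸ I) ⊗ₜ[ℤ] 1) :
      F.TensorQuotients (R ⧸ I)) = 0 := (hF (R ⧸ I)).1 (hker.trans (map_zero _).symm)
  have h2 : θ ((Submodule.Quotient.mk 1 : R ⧸ I) ⊗ₜ[ℤ] 1) = 0 :=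
    hrel ((QuotientAddGroup.eq_zero_iff _).1 h1)
  rw [hθ, mul_one, hp] at h2
  exact h2

theorem isPerfect_of_one_mem_extend
    (h : ∀ I ∈ F.sets, (1 : F.Quotients R) ∈ F.extend I) : F.IsPerfect := by
  intro M _ _
  -- right multiplication by `z` on `M ⊗_R R_F`
  let ρ : F.Quotients R → (M ⊗[ℤ] F.Quotients R →+ M ⊗[ℤ] F.Quotients R) := fun z =>
    (TensorProduct.map LinearMap.id (AddMonoidHom.mulRight z).toIntLinearMap).toAddMonoidHom
  have hρ : ∀ z m x, ρ z (m ⊗ₜ[ℤ] x) = m ⊗ₜ[ℤ] (x * z) := fun _ _ _ => rfl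
  have hρadd : ∀ z z' t, ρ (z + z') t = ρ z t + ρ z' t := fun z z' t => by
    induction t with
    | zero => simp
    | tmul m x => rw [hρ, hρ, hρ, mul_add, TensorProduct.tmul_add]
    | add a b ha hb => rw [_root_.map_add, _root_.map_add, _root_.map_add, ha, hb]; abel
  have hρmul : ∀ z z' t, ρ (z * z') t = ρ z' (ρ z t) := fun z z' t => by
    induction t with
    | zero => simp
    | tmul m x => rw [hρ, hρ, hρ, mul_assoc]
    | add a b ha hb => rw [_root_.map_add, _root_.map_add, _root_.map_add, ha, hb]
  have hρone : ∀ t, ρ 1 t = t := fun t => by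
    induction t with
    | zero => simp
    | tmul m x => rw [hρ, mul_one]
    | add a b ha hb => rw [_root_.map_add, ha, hb]
  have hρzero : ∀ t, ρ 0 t = 0 := fun t => by
    have h1 := hρadd 0 0 t
    rw [add_zero] at h1
    exact left_eq_add.1 h1
  have hgen : ∀ (m : M) (r : R) (x : F.Quotients R),
      (op r • m) ⊗ₜ[ℤ] x - m ⊗ₜ[ℤ] (F.toQuot r * x) ∈ F.tensorRel M :=
    fun m r x => AddSubgroup.subset_closure ⟨m, r, x, rfl⟩
  have hρrel : ∀ z, ∀ t ∈ F.tensorRel M, ρ z t ∈ F.tensorRel M := fun z t ht => by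
    refine (AddSubgroup.closure_le ((F.tensorRel M).comap (ρ z))).2 ?_ ht
    rintro _ ⟨m, r, x, rfl⟩
    change ρ z _ ∈ F.tensorRel M
    rw [_root_.map_sub, hρ, hρ, mul_assoc]
    exact hgen _ _ _
  -- an element which is annihilated by a right ideal in `F` is zero
  have hzero : ∀ t, ∀ I ∈ F.sets, (∀ a ∈ I, ρ (F.toQuot a) t ∈ F.tensorRel M) →
      t ∈ F.tensorRel M := fun t I hI ht => by
    have h1 : ∀ z ∈ F.extend I, ρ z t ∈ F.tensorRel M := fun z hz => by
      induction hz using Submodule.span_induction with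
      | mem z hz => obtain ⟨a, ha, rfl⟩ := hz; exact ht a ha
      | zero => rw [hρzero]; exact zero_mem _
      | add z z' _ _ hz hz' => rw [hρadd]; exact add_mem hz hz'
      | smul c z _ hz =>
        rw [show c • z = z * unop c from rfl, hρmul]
        exact hρrel _ _ hz
    have h2 := h1 1 (h I hI)
    rwa [hρone] at h2
  have hloc : ∀ t, ∃ I ∈ F.sets, ∀ a ∈ I, ∃ n : M,
      ρ (F.toQuot a) t - n ⊗ₜ[ℤ] 1 ∈ F.tensorRel M := fun t => by
    induction t with
    | zero => exact ⟨⊤, F.top_mem, fun a _ => ⟨0, by simp [zero_mem]⟩⟩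
    | tmul m x =>
      obtain ⟨I, hI, h1⟩ := exists_act_eq_toQuot x
      refine ⟨I, hI, fun a ha => ?_⟩
      obtain ⟨r, hr⟩ := h1 a ha
      refine ⟨op r • m, ?_⟩
      have h2 := neg_mem (hgen m r 1)
      rw [neg_sub, mul_one, ← hr] at h2
      exact h2
    | add s t hs ht =>
      obtain ⟨I, hI, h1⟩ := hs
      obtain ⟨J, hJ, h2⟩ := ht
      refine ⟨_, F.inf_mem hI hJ, fun a ha => ?_⟩
      obtain ⟨n, hn⟩ := h1 a ha.1
      obtain ⟨n', hn'⟩ := h2 a ha.2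
      refine ⟨n + n', ?_⟩
      rw [_root_.map_add, TensorProduct.add_tmul, add_sub_add_comm]
      exact add_mem hn hn'
  have hmap : ∀ z t, F.tensorIntMap M (ρ z t) = act (F.tensorIntMap M t) z := fun z t => by
    induction t with
    | zero =>
      have h1 : act (0 : F.Quotients M) z = act 0 z + act 0 z := by rw [← add_act, add_zero]
      rw [_root_.map_zero, _root_.map_zero, left_eq_add.1 h1]
    | tmul m x => rw [hρ, tensorIntMap_tmul, tensorIntMap_tmul, mul_def, act_assoc]
    | add s t hs ht => rw [_root_.map_add, _root_.map_add, _root_.map_add, add_act, hs, ht]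
  have hz0 : ∀ z, act (0 : F.Quotients M) z = 0 := fun z => by
    have h1 := hmap z 0
    rw [_root_.map_zero, _root_.map_zero] at h1
    exact h1.symm
  constructor
  · refine (injective_iff_map_eq_zero _).2 fun y hy => ?_
    obtain ⟨t, rfl⟩ := QuotientAddGroup.mk_surjective y
    have hy' : F.tensorIntMap M t = 0 := hy
    obtain ⟨I, hI, h1⟩ := hloc t
    refine (QuotientAddGroup.eq_zero_iff t).2 (hzero t I hI fun a ha => ?_)
    obtain ⟨n, hn⟩ := h1 a ha
    have h2 := F.tensorRel_le_ker M hn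
    rw [AddMonoidHom.mem_ker, _root_.map_sub, hmap, hy', hz0, tensorIntMap_tmul, one_def, act_one,
      zero_sub, neg_eq_zero, toQuot_eq_zero_iff, mem_torsion] at h2
    have h3 : n ⊗ₜ[ℤ] (1 : F.Quotients R) ∈ F.tensorRel M := hzero _ _ h2 fun b hb => by
      have h4 := neg_mem (hgen n b 1)
      have h5 : op b • n = 0 := hb
      rw [neg_sub, mul_one, h5, TensorProduct.zero_tmul, sub_zero] at h4
      rw [hρ, one_mul]
      exact h4
    have h6 := add_mem hn h3
    rwa [sub_add_cancel] at h6
  · intro x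
    obtain ⟨I, hI, h1⟩ := exists_act_eq_toQuot x
    have h2 : ∀ z ∈ F.extend I, act x z ∈ (F.tensorMap M).range := fun z hz => by
      induction hz using Submodule.span_induction with
      | mem z hz =>
        obtain ⟨a, ha, rfl⟩ := hz
        obtain ⟨m, hm⟩ := h1 a ha
        refine ⟨QuotientAddGroup.mk (m ⊗ₜ[ℤ] 1), ?_⟩
        rw [hm]
        exact act_one (F.toQuot m)
      | zero =>
        have h3 : act x (0 : F.Quotients R) = act x 0 + act x 0 := by rw [← act_add, add_zero]
        rw [left_eq_add.1 h3]
        exact zero_mem _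
      | add z z' _ _ hz hz' => rw [act_add]; exact add_mem hz hz'
      | smul c z _ hz =>
        obtain ⟨y, hy⟩ := hz
        obtain ⟨t, rfl⟩ := QuotientAddGroup.mk_surjective y
        refine ⟨QuotientAddGroup.mk (ρ (unop c) t), ?_⟩
        change F.tensorIntMap M t = act x z at hy
        change F.tensorIntMap M (ρ (unop c) t) = act x (z * unop c)
        rw [hmap, hy, mul_def, act_assoc]
    have h3 := h2 1 (h I hI)
    rw [one_def, act_one] at h3
    exact h3

theorem toQuot_mul (G : GabrielFilter R) (r s : R) :
    G.toQuot r * G.toQuot s = G.toQuot (r * s) := act_toQuot r s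

theorem toQuot_mul_mem_extend {I J : Submodule Rᵐᵒᵖ R} {r : R} (h : ∀ s ∈ I, r * s ∈ J)
    {z : G.Quotients R} (hz : z ∈ G.extend I) : G.toQuot r * z ∈ G.extend J := by
  induction hz using Submodule.span_induction with
  | mem z hz =>
    obtain ⟨s, hs, rfl⟩ := hz
    rw [toQuot_mul]
    exact toQuot_mem_extend (h s hs)
  | zero => rw [mul_zero]; exact zero_mem _
  | add z z' _ _ hz hz' => rw [mul_add]; exact add_mem hz hz'
  | smul c z _ hz =>
    rw [show c • z = z * unop c from rfl, ← mul_assoc]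
    exact rightIdeal_mul_mem hz _

theorem one_mem_extend_of_forall {I J : Submodule Rᵐᵒᵖ R} (hI : (1 : G.Quotients R) ∈ G.extend I)
    (h : ∀ r ∈ I, G.toQuot r ∈ G.extend J) : (1 : G.Quotients R) ∈ G.extend J :=
  (Submodule.span_le (p := G.extend J)).2 (by rintro _ ⟨r, hr, rfl⟩; exact h r hr) hI

/-- The right ideals `I` such that `(I : a) R_G = R_G` for all `a ∈ R`. -/
noncomputable def extendFilter (G : GabrielFilter R) : GabrielFilter R where
  sets := {I | ∀ a, (1 : G.Quotients R) ∈ G.extend (rightColon I a)}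
  top_mem _ := toQuot_mem_extend (F := G) trivial
  mem_of_le h hle a :=
    one_mem_extend_of_forall (h a) fun r hr => toQuot_mem_extend (F := G) (hle hr)
  inf_mem {I J} hI hJ a := one_mem_extend_of_forall (hI a) fun r hr => by
    rw [← mul_one (G.toQuot r)]
    refine toQuot_mul_mem_extend (J := rightColon (I ⊓ J) a) (fun s hs => ⟨?_, ?_⟩) (hJ (a * r))
    · exact rightIdeal_mul_mem (I := rightColon I a) hr s
    · change a * (r * s) ∈ J
      rw [← mul_assoc]; exact hs
  colon_mem {I} h c a := by
    have h1 : rightColon (rightColon I c) a = rightColon I (c * a) := by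
      ext r; simp [mul_assoc]
    rw [h1]
    exact h (c * a)
  mem_of_colon {I J} hI hJ a := one_mem_extend_of_forall (hI a) fun r hr => by
    rw [← mul_one (G.toQuot r)]
    refine toQuot_mul_mem_extend (J := rightColon J a) (fun s hs => ?_) (hJ (a * r) hr 1)
    have hs' : a * r * (1 * s) ∈ J := hs
    rw [one_mul, mul_assoc] at hs'
    exact hs'

theorem IsPerfect.le_extendFilter (hF : F.IsPerfect) (h : F ≤ G) : F ≤ G.extendFilter := by
  intro I hI a
  have h1 : ∀ z ∈ F.extend (rightColon I a), quotMap h z ∈ G.extend (rightColon I a) :=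
    fun z hz => by
      induction hz using Submodule.span_induction with
      | mem z hz => obtain ⟨r, hr, rfl⟩ := hz; exact toQuot_mem_extend hr
      | zero =>
        have h2 := quotMap_add h (0 : F.Quotients R) 0
        rw [add_zero] at h2
        rw [left_eq_add.1 h2]
        exact zero_mem _
      | add z z' _ _ hz hz' => rw [quotMap_add]; exact add_mem hz hz'
      | smul c z _ hz =>
        rw [show c • z = act z (unop c) from rfl, quotMap_act]
        exact rightIdeal_mul_mem hz _
  exact h1 1 (hF.one_mem_extend (F.colon_mem hI a))

/-- A join of perfect filters is perfect. -/
theorem isPerfect_join {S : Set (GabrielFilter R)} (hS : ∀ F ∈ S, F.IsPerfect) :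
    (join S).IsPerfect := by
  refine isPerfect_of_one_mem_extend fun I hI => ?_
  have h1 : join S ≤ (join S).extendFilter :=
    (isLUB_join S).2 fun F hF => (hS F hF).le_extendFilter ((isLUB_join S).1 hF)
  have h2 := h1 hI 1
  have h3 : rightColon I 1 = I := by ext r; simp
  rwa [h3] at h2

end PerfectCriterion

/-! ### The Lambek, Goldie, classical and maximal perfect torsion theories -/

section Examples

variable (R : Type u) [Ring R]

variable {R} in
/-- Dense right ideals. -/
def IsDenseIdeal (I : Submodule Rᵐᵒᵖ R) : Prop :=
  ∀ a b : R, b ≠ 0 → ∃ r : R, a * r ∈ I ∧ b * r ≠ 0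

/-- The filter of the Lambek torsion theory: all dense right ideals. Its right ring of quotients
is the maximal right ring of quotients. -/
def lambek : GabrielFilter R where
  sets := {I | IsDenseIdeal I}
  top_mem _ b hb := ⟨1, trivial, by rwa [mul_one]⟩
  mem_of_le h hle a b hb := by
    obtain ⟨r, h1, h2⟩ := h a b hb
    exact ⟨r, hle h1, h2⟩
  inf_mem {I J} h h' a b hb := by
    obtain ⟨r, h1, h2⟩ := h a b hb
    obtain ⟨s, h3, h4⟩ := h' (a * r) (b * r) h2
    refine ⟨r * s, ⟨?_, ?_⟩, ?_⟩
    · rw [← mul_assoc]; exact rightIdeal_mul_mem h1 s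
    · rw [← mul_assoc]; exact h3
    · rw [← mul_assoc]; exact h4
  colon_mem {I} h c a b hb := by
    obtain ⟨r, h1, h2⟩ := h (c * a) b hb
    exact ⟨r, by rw [mem_rightColon, ← mul_assoc]; exact h1, h2⟩
  mem_of_colon {I J} h h' a b hb := by
    obtain ⟨r, h1, h2⟩ := h a b hb
    obtain ⟨s, h3, h4⟩ := h' (a * r) h1 1 (b * r) h2
    rw [mem_rightColon, one_mul] at h3
    exact ⟨r * s, by rw [← mul_assoc]; exact h3, by rw [← mul_assoc]; exact h4⟩

/-- The Lambek torsion theory is the largest faithful hereditary torsion theory. -/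
theorem isGreatest_lambek : IsGreatest {F : GabrielFilter R | F.IsFaithful} (lambek R) := by
  constructor
  · refine (Submodule.eq_bot_iff _).2 fun b hb => ?_
    by_contra hne
    obtain ⟨r, h1, h2⟩ := (mem_torsion.1 hb) 1 b hne
    rw [one_mul] at h1
    exact h2 h1
  · intro F hF I hI a b hb
    by_contra! hcon
    refine hb ((Submodule.eq_bot_iff _).1 hF b (mem_torsion.2 (F.mem_of_le (F.colon_mem hI a) ?_)))
    intro r hr
    exact hcon r hr

variable {R} in
/-- Essential right ideals. -/
def IsEssentialIdeal (I : Submodule Rᵐᵒᵖ R) : Prop :=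
  ∀ J : Submodule Rᵐᵒᵖ R, J ≠ ⊥ → I ⊓ J ≠ ⊥

/-- A right module is nonsingular if no nonzero element has an essential right annihilator. -/
def IsNonsingularModule (N : Type v) [AddCommGroup N] [Module Rᵐᵒᵖ N] : Prop :=
  ∀ x : N, IsEssentialIdeal (rightAnn x : Submodule Rᵐᵒᵖ R) → x = 0

/-- The filter of the Goldie torsion theory: the smallest Gabriel filter which contains all
essential right ideals. -/
def goldie : GabrielFilter R :=
  inter {F | ∀ I : Submodule Rᵐᵒᵖ R, IsEssentialIdeal I → I ∈ F.sets}

variable {R} in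
theorem IsEssentialIdeal.colon {I : Submodule Rᵐᵒᵖ R} (h : IsEssentialIdeal I) (a : R) :
    IsEssentialIdeal (rightColon I a) := by
  intro J hJ
  by_cases h0 : J.map (leftMulMap a) = ⊥
  · have hle : J ≤ rightColon I a := fun r hr => by
      have h1 : leftMulMap a r = 0 := (Submodule.eq_bot_iff _).1 h0 _ ⟨r, hr, rfl⟩
      change leftMulMap a r ∈ I
      rw [h1]; exact I.zero_mem
    rwa [inf_eq_right.2 hle]
  · obtain ⟨y, ⟨hyI, r, hr, rfl⟩, hy0⟩ := (Submodule.ne_bot_iff _).1 (h _ h0)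
    refine (Submodule.ne_bot_iff _).2 ⟨r, ⟨hyI, hr⟩, ?_⟩
    rintro rfl
    exact hy0 (map_zero _)

/-- The Gabriel filter `{I | x (I : a) = 0 implies x = 0, for all a ∈ R and x ∈ N}`, for which `N`
is torsion-free. -/
def cogenerated (N : Type v) [AddCommGroup N] [Module Rᵐᵒᵖ N] : GabrielFilter R where
  sets := {I | ∀ (a : R) (x : N), (∀ r, a * r ∈ I → op r • x = 0) → x = 0}
  top_mem a x h := by simpa using h 1 trivial
  mem_of_le h hle a x hx := h a x fun r hr => hx r (hle hr)
  inf_mem {I J} h h' a x hx := h a x fun r hr => h' (a * r) (op r • x) fun s hs => by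
    rw [← mul_smul, ← op_mul]
    refine hx _ ⟨?_, ?_⟩
    · rw [← mul_assoc]; exact rightIdeal_mul_mem hr s
    · rw [← mul_assoc]; exact hs
  colon_mem {I} h c a x hx := h (c * a) x fun r hr => hx r (by
    rw [mem_rightColon, ← mul_assoc]; exact hr)
  mem_of_colon {I J} h h' a x hx := h a x fun r hr => h' (a * r) hr 1 (op r • x) fun s hs => by
    rw [mem_rightColon, one_mul] at hs
    rw [← mul_smul, ← op_mul]
    exact hx _ (by rw [← mul_assoc]; exact hs)

/-- The torsion-free modules of the Goldie torsion theory are the nonsingular modules. -/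
theorem goldie_torsion_eq_bot_iff (N : Type v) [AddCommGroup N] [Module Rᵐᵒᵖ N] :
    (goldie R).torsion N = ⊥ ↔ IsNonsingularModule R N := by
  constructor
  · intro h x hx
    exact (Submodule.eq_bot_iff _).1 h x (mem_torsion.2 fun F hF => hF _ hx)
  · intro h
    refine (Submodule.eq_bot_iff _).2 fun x hx => ?_
    have h1 : rightAnn x ∈ (cogenerated R N).sets := hx _ fun I hI a y hy =>
      h y fun J hJ hbot => (hI.colon a) J hJ
        ((Submodule.eq_bot_iff _).2 fun r hr =>
          (Submodule.eq_bot_iff _).1 hbot r ⟨hy r hr.1, hr.2⟩)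
    exact h1 1 x fun r hr => by
      rw [one_mul] at hr
      exact hr

/-- `R` is a right Ore ring: `r T ∩ t R` is nonempty for all `r ∈ R` and `t ∈ T`, where `T` is
the set of regular elements. -/
def IsRightOre : Prop :=
  ∀ r : R, ∀ t ∈ nonZeroDivisors R, ∃ t' ∈ nonZeroDivisors R, ∃ r' : R, r * t' = t * r'

/-- The filter of the classical torsion theory: the right ideals `I` such that every element of
`R / I` is annihilated by a regular element. -/
def classical : GabrielFilter R where
  sets := {I | ∀ a : R, ∃ t ∈ nonZeroDivisors R, a * t ∈ I}
  top_mem _ := ⟨1, one_mem _, trivial⟩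
  mem_of_le h hle a := by
    obtain ⟨t, ht, h1⟩ := h a
    exact ⟨t, ht, hle h1⟩
  inf_mem {I J} h h' a := by
    obtain ⟨t, ht, h1⟩ := h a
    obtain ⟨s, hs, h2⟩ := h' (a * t)
    refine ⟨t * s, mul_mem ht hs, ?_, ?_⟩
    · rw [← mul_assoc]; exact rightIdeal_mul_mem h1 s
    · rw [← mul_assoc]; exact h2
  colon_mem {I} h c a := by
    obtain ⟨t, ht, h1⟩ := h (c * a)
    exact ⟨t, ht, by rw [mem_rightColon, ← mul_assoc]; exact h1⟩
  mem_of_colon {I J} h h' a := by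
    obtain ⟨t, ht, h1⟩ := h a
    obtain ⟨s, hs, h2⟩ := h' (a * t) h1 1
    rw [mem_rightColon, one_mul] at h2
    exact ⟨t * s, mul_mem ht hs, by rw [← mul_assoc]; exact h2⟩

/-- For a right Ore ring, an element of a right module is torsion for the classical torsion theory
iff it is annihilated by a regular element. -/
theorem mem_classical_torsion_iff (h : IsRightOre R) {M : Type v} [AddCommGroup M]
    [Module Rᵐᵒᵖ M] {m : M} :
    m ∈ (classical R).torsion M ↔ ∃ t ∈ nonZeroDivisors R, op t • m = 0 := by
  constructor
  · intro hm
    obtain ⟨t, ht, h1⟩ := (mem_torsion.1 hm) 1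
    rw [one_mul] at h1
    exact ⟨t, ht, h1⟩
  · rintro ⟨t, ht, h1⟩ a
    obtain ⟨t', ht', r', h2⟩ := h a t ht
    refine ⟨t', ht', ?_⟩
    rw [h2, mem_rightAnn, op_mul, mul_smul, h1, smul_zero]

/-- The filter of the maximal perfect torsion theory: the join of all faithful perfect filters.
Its right ring of quotients is the total right ring of quotients. -/
def total : GabrielFilter R := join {F | F.IsFaithful ∧ F.IsPerfect}

/-- The join in the definition of `total` is itself faithful and perfect: it is the largest
faithful perfect filter. -/
theorem isGreatest_total :
    IsGreatest {F : GabrielFilter R | F.IsFaithful ∧ F.IsPerfect} (total R) := by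
  refine ⟨⟨?_, isPerfect_join fun F hF => hF.2⟩, (isLUB_join _).1⟩
  have h1 : total R ≤ lambek R := (isLUB_join _).2 fun F hF => (isGreatest_lambek R).2 hF.1
  exact eq_bot_iff.2 ((torsion_mono h1).trans (isGreatest_lambek R).1.le)

end Examples

/-! ### Extensions of derivations -/

section Extensions

variable {R : Type u} [Ring R]

/-- `D` is a derivation of the ring `R_F` which extends the derivation `δ` of `R`:
`D ∘ q_R = q_R ∘ δ`. -/
structure IsRingExtension (F : GabrielFilter R) (δ : R → R) (D : F.Quotients R → F.Quotients R) :
    Prop where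
  isRingDerivation : IsRingDerivation D
  apply_toQuot : ∀ r, D (F.toQuot r) = F.toQuot (δ r)

/-- `D` is a `δ`-derivation of `M_F` which extends the `δ`-derivation `d` of `M`:
`D ∘ q_M = q_M ∘ d`. -/
structure IsModuleExtension (F : GabrielFilter R) (δ : R → R) {M : Type v} [AddCommGroup M]
    [Module Rᵐᵒᵖ M] (d : M → M) (D : F.Quotients M → F.Quotients M) : Prop where
  isModuleDerivation : IsModuleDerivation δ D
  apply_toQuot : ∀ m, D (F.toQuot m) = F.toQuot (d m)

/-- `F ⊆ G`, the derivation `δ` of `R` extends uniquely to `R_F` and to `R_G`, and the two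
extensions `D₁` and `D₂` agree: `q₁₂ ∘ D₁ = D₂ ∘ q₁₂`. -/
def RingExtensionsAgree (F G : GabrielFilter R) (δ : R → R) : Prop :=
  ∃ (h : F ≤ G) (D₁ : F.Quotients R → F.Quotients R) (D₂ : G.Quotients R → G.Quotients R),
    (F.IsRingExtension δ D₁ ∧ ∀ D, F.IsRingExtension δ D → D = D₁) ∧
    (G.IsRingExtension δ D₂ ∧ ∀ D, G.IsRingExtension δ D → D = D₂) ∧
    ∀ x, quotMap h (D₁ x) = D₂ (quotMap h x)

/-- `F ⊆ G`, the `δ`-derivation `d` of `M` extends uniquely to `M_F` and to `M_G`, and the two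
extensions `D₁` and `D₂` agree: `q₁₂ ∘ D₁ = D₂ ∘ q₁₂`. -/
def ModuleExtensionsAgree (F G : GabrielFilter R) (δ : R → R) {M : Type v} [AddCommGroup M]
    [Module Rᵐᵒᵖ M] (d : M → M) : Prop :=
  ∃ (h : F ≤ G) (D₁ : F.Quotients M → F.Quotients M) (D₂ : G.Quotients M → G.Quotients M),
    (F.IsModuleExtension δ d D₁ ∧ ∀ D, F.IsModuleExtension δ d D → D = D₁) ∧
    (G.IsModuleExtension δ d D₂ ∧ ∀ D, G.IsModuleExtension δ d D → D = D₂) ∧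
    ∀ x, quotMap h (D₁ x) = D₂ (quotMap h x)

end Extensions

end GabrielFilter

/-!
A `δ`-derivation `d` of `M` is the same as a linear map `x ↦ x + d(x) ε` into `M[ε]`, the right
`R[ε]`-module `M ⊕ M ε` restricted along the ring homomorphism `R → R[ε]`, `r ↦ r + δ(r) ε`.
Being an extension of `N` by itself, `N[ε]` is `F`-torsion-free or `F`-closed whenever `N` is. Hence
the universal property of `q : M → M_F` with respect to linear maps into `F`-closed modules applies
with target `M_F[ε]` and extends `d` uniquely to `M_F`. For `F ⊆ G` both `q₁₂ ∘ D₁` and `D₂ ∘ q₁₂`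
are derivations along `q₁₂` which restrict to `q₂ ∘ d` on `M`; since `M_G[ε]` is `F`-torsion-free,
they coincide. The same uniqueness, applied to the derivations `y ↦ D(x y)` and
`y ↦ D(x) y + x D(y)` along `y ↦ x y`, shows that the extension `D` of `δ` to `R_F` satisfies the
Leibniz rule. It remains to compare the filters: classical ⊆ total ⊆ Lambek ⊆ Goldie, the first
inclusion because regular elements of a right Ore ring become right invertible in `Q_cl(R)`.
-/

namespace IsRingDerivation

variable {R : Type u} [Ring R] {δ : R → R}

theorem map_zero (hδ : IsRingDerivation δ) : δ 0 = 0 := by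
  simpa using hδ.map_add 0 0

theorem map_one (hδ : IsRingDerivation δ) : δ 1 = 0 := by
  simpa using hδ.map_mul 1 1

theorem isModuleDerivation (hδ : IsRingDerivation δ) : IsModuleDerivation δ δ where
  map_add := hδ.map_add
  map_smul := hδ.map_mul

end IsRingDerivation

/-- A `δ`-derivation `d : M → N` along a linear map `φ : M → N` of right modules; the
`δ`-derivations of `M` are those along the identity. -/
structure IsDerivationAlong {R : Type u} [Ring R] {M : Type v} [AddCommGroup M] [Module Rᵐᵒᵖ M]
    {N : Type w} [AddCommGroup N] [Module Rᵐᵒᵖ N] (δ : R → R) (φ : M →ₗ[Rᵐᵒᵖ] N) (d : M → N) :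
    Prop where
  map_add : ∀ x y, d (x + y) = d x + d y
  map_smul : ∀ (x : M) (r : R), d (op r • x) = op r • d x + op (δ r) • φ x

/-- The right module `N[ε] = N ⊕ N ε` with the action `(x + y ε) r = x r + (y r + x δ(r)) ε`, which
is the restriction of scalars along the ring homomorphism `R → R[ε]`, `r ↦ r + δ(r) ε`. Linear maps
into `N[ε]` are derivations, see `IsDerivationAlong.toDualNumberModule`. The proof that `δ` is a
derivation is a parameter of the type so that the module structure can be an instance. -/
@[ext]
structure DualNumberModule {R : Type u} [Ring R] {δ : R → R} (_hδ : IsRingDerivation δ)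
    (N : Type w) where
  fst : N
  snd : N

namespace DualNumberModule

variable {R : Type u} [Ring R] {δ : R → R} {hδ : IsRingDerivation δ}
variable {N : Type w} [AddCommGroup N]

instance : AddCommGroup (DualNumberModule hδ N) :=
  Equiv.addCommGroup (β := N × N) ⟨fun p => (p.fst, p.snd), fun p => ⟨p.1, p.2⟩,
    fun _ => rfl, fun _ => rfl⟩

theorem snd_add (p q : DualNumberModule hδ N) : (p + q).snd = p.snd + q.snd := rfl

variable [Module Rᵐᵒᵖ N]

instance : Module Rᵐᵒᵖ (DualNumberModule hδ N) where
  smul c p := ⟨c • p.fst, c • p.snd + op (δ (unop c)) • p.fst⟩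
  one_smul p := DualNumberModule.ext (one_smul _ p.fst) <| by
    change (1 : Rᵐᵒᵖ) • p.snd + op (δ 1) • p.fst = p.snd
    rw [hδ.map_one, op_zero, zero_smul, one_smul, add_zero]
  mul_smul b c p := DualNumberModule.ext (mul_smul b c p.fst) <| by
    change (b * c) • p.snd + op (δ (unop c * unop b)) • p.fst =
      b • (c • p.snd + op (δ (unop c)) • p.fst) + op (δ (unop b)) • c • p.fst
    rw [hδ.map_mul, op_add, op_mul, op_mul, op_unop, op_unop, add_smul, smul_add, mul_smul,
      mul_smul, mul_smul, add_assoc]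
  smul_zero c := DualNumberModule.ext (smul_zero c) <| by
    change c • (0 : N) + op (δ (unop c)) • (0 : N) = 0
    rw [smul_zero, smul_zero, add_zero]
  smul_add c p q := DualNumberModule.ext (smul_add c p.fst q.fst) <| by
    change c • (p.snd + q.snd) + op (δ (unop c)) • (p.fst + q.fst) =
      c • p.snd + op (δ (unop c)) • p.fst + (c • q.snd + op (δ (unop c)) • q.fst)
    rw [smul_add, smul_add, add_add_add_comm]
  add_smul b c p := DualNumberModule.ext (add_smul b c p.fst) <| by
    change (b + c) • p.snd + op (δ (unop b + unop c)) • p.fst =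
      b • p.snd + op (δ (unop b)) • p.fst + (c • p.snd + op (δ (unop c)) • p.fst)
    rw [hδ.map_add, op_add, add_smul, add_smul, add_add_add_comm]
  zero_smul p := DualNumberModule.ext (zero_smul _ p.fst) <| by
    change (0 : Rᵐᵒᵖ) • p.snd + op (δ 0) • p.fst = 0
    rw [hδ.map_zero, op_zero, zero_smul, zero_smul, add_zero]

theorem snd_smul (c : Rᵐᵒᵖ) (p : DualNumberModule hδ N) :
    (c • p).snd = c • p.snd + op (δ (unop c)) • p.fst := rfl

variable (hδ N) in
/-- The projection `N[ε] → N`, `x + y ε ↦ x`, as a linear map. -/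
def fstₗ : DualNumberModule hδ N →ₗ[Rᵐᵒᵖ] N where
  toFun := fst
  map_add' _ _ := rfl
  map_smul' _ _ := rfl

end DualNumberModule

namespace IsDerivationAlong

variable {R : Type u} [Ring R] {δ : R → R}
variable {L M N : Type*} [AddCommGroup L] [Module Rᵐᵒᵖ L] [AddCommGroup M] [Module Rᵐᵒᵖ M]
  [AddCommGroup N] [Module Rᵐᵒᵖ N] {φ : M →ₗ[Rᵐᵒᵖ] N} {d : M → N}

/-- The linear map `x ↦ φ(x) + d(x) ε` of a derivation `d` along `φ`. -/
def toDualNumberModule (hδ : IsRingDerivation δ) (hd : IsDerivationAlong δ φ d) :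
    M →ₗ[Rᵐᵒᵖ] DualNumberModule hδ N where
  toFun x := ⟨φ x, d x⟩
  map_add' x y := DualNumberModule.ext (_root_.map_add φ x y) (hd.map_add x y)
  map_smul' c x := DualNumberModule.ext (_root_.map_smul φ c x) (hd.map_smul x (unop c))

theorem of_linearMap {hδ : IsRingDerivation δ} (f : M →ₗ[Rᵐᵒᵖ] DualNumberModule hδ N) :
    IsDerivationAlong δ (DualNumberModule.fstₗ hδ N ∘ₗ f) fun x => (f x).snd where
  map_add x y := congrArg DualNumberModule.snd (_root_.map_add f x y)
  map_smul x r := congrArg DualNumberModule.snd (_root_.map_smul f (op r) x)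

theorem linearMap_comp (hd : IsDerivationAlong δ φ d) (ψ : N →ₗ[Rᵐᵒᵖ] L) :
    IsDerivationAlong δ (ψ ∘ₗ φ) (ψ ∘ d) where
  map_add x y := by simp only [Function.comp_apply, hd.map_add, _root_.map_add]
  map_smul x r := by
    simp only [Function.comp_apply, hd.map_smul, _root_.map_add, _root_.map_smul,
      LinearMap.comp_apply]

theorem comp_linearMap (hd : IsDerivationAlong δ φ d) (ψ : L →ₗ[Rᵐᵒᵖ] M) :
    IsDerivationAlong δ (φ ∘ₗ ψ) (d ∘ ψ) where
  map_add x y := by simp only [Function.comp_apply, hd.map_add, _root_.map_add]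
  map_smul x r := by
    simp only [Function.comp_apply, hd.map_smul, _root_.map_smul, LinearMap.comp_apply]

theorem linearMap_add (hd : IsDerivationAlong δ φ d) (ψ : M →ₗ[Rᵐᵒᵖ] N) :
    IsDerivationAlong δ φ fun x => ψ x + d x where
  map_add x y := by rw [hd.map_add, _root_.map_add, add_add_add_comm]
  map_smul x r := by rw [hd.map_smul, _root_.map_smul, smul_add, add_assoc]

end IsDerivationAlong

theorem isDerivationAlong_id_iff {R : Type u} [Ring R] {δ : R → R} {M : Type v} [AddCommGroup M]
    [Module Rᵐᵒᵖ M] {d : M → M} :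
    IsDerivationAlong δ LinearMap.id d ↔ IsModuleDerivation δ d :=
  ⟨fun h => ⟨h.map_add, h.map_smul⟩, fun h => ⟨h.map_add, h.map_smul⟩⟩

namespace GabrielFilter

section ClosedModules

variable {R : Type u} [Ring R] {F : GabrielFilter R}
variable {L M N : Type*} [AddCommGroup L] [Module Rᵐᵒᵖ L] [AddCommGroup M] [Module Rᵐᵒᵖ M]
  [AddCommGroup N] [Module Rᵐᵒᵖ N]

theorem eq_of_forall_op_smul_eq (hN : F.torsion N = ⊥) {I : Submodule Rᵐᵒᵖ R} (hI : I ∈ F.sets)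
    {x y : N} (h : ∀ a ∈ I, op a • x = op a • y) : x = y := by
  have hxy : x - y ∈ F.torsion N := mem_torsion.2 <| F.mem_of_le hI fun a ha => by
    rw [mem_rightAnn, smul_sub, h a ha, sub_self]
  rwa [hN, Submodule.mem_bot, sub_eq_zero] at hxy

theorem map_mem_torsion (φ : M →ₗ[Rᵐᵒᵖ] N) {m : M} (hm : m ∈ F.torsion M) :
    φ m ∈ F.torsion N :=
  mem_torsion.2 <| F.mem_of_le (mem_torsion.1 hm) fun r hr => by
    rw [mem_rightAnn] at hr ⊢
    rw [← map_smul, hr, map_zero]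

/-- A submodule `P` of a right module `L` is `F`-dense if `L / P` is `F`-torsion, that is, if
`{r | x r ∈ P} ∈ F` for all `x ∈ L`. -/
def IsDenseSubmodule (F : GabrielFilter R) (P : Submodule Rᵐᵒᵖ L) : Prop :=
  ∀ x : L, P.comap (leftMulMap x) ∈ F.sets

/-- A right module `N` is `F`-closed if it is `F`-torsion-free and every homomorphism `I → N` with
`I ∈ F` is left multiplication by an element of `N`. -/
structure IsClosedModule (F : GabrielFilter R) (N : Type*) [AddCommGroup N] [Module Rᵐᵒᵖ N] :
    Prop where
  torsion_eq_bot : F.torsion N = ⊥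
  exists_op_smul_eq : ∀ f : R →ₗ.[Rᵐᵒᵖ] N, f.domain ∈ F.sets →
    ∃ n, ∀ a : f.domain, op (a : R) • n = f a

theorem linearMap_ext_of_isDenseSubmodule (hN : F.torsion N = ⊥) {q : M →ₗ[Rᵐᵒᵖ] L}
    (hq : F.IsDenseSubmodule (LinearMap.range q)) {f g : L →ₗ[Rᵐᵒᵖ] N} (h : f ∘ₗ q = g ∘ₗ q) :
    f = g := by
  ext x
  refine eq_of_forall_op_smul_eq hN (hq x) fun a ha => ?_
  obtain ⟨m, hm : q m = op a • x⟩ := ha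
  rw [← map_smul, ← map_smul, ← hm]
  exact LinearMap.congr_fun h m

theorem IsClosedModule.exists_linearMap_extending (hN : F.IsClosedModule N) (f : L →ₗ.[Rᵐᵒᵖ] N)
    (hf : F.IsDenseSubmodule f.domain) : ∃ ψ : L →ₗ[Rᵐᵒᵖ] N, ∀ x : f.domain, ψ x = f x := by
  have pointwise (x : L) : ∃ n, ∀ (a : R) (h : op a • x ∈ f.domain), op a • n = f ⟨_, h⟩ := by
    obtain ⟨n, hn⟩ := hN.exists_op_smul_eq
      ⟨_, f.toFun ∘ₗ (leftMulMap x).submoduleComap f.domain⟩ (hf x)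
    exact ⟨n, fun a h => hn ⟨a, h⟩⟩
  choose ψ hψ using pointwise
  refine ⟨⟨⟨ψ, fun x y => ?_⟩, fun c x => ?_⟩, fun x => ?_⟩
  · refine eq_of_forall_op_smul_eq hN.torsion_eq_bot (F.inf_mem (hf x) (hf y)) fun a ha => ?_
    have hx : op a • x ∈ f.domain := ha.1
    have hy : op a • y ∈ f.domain := ha.2
    have hxy : op a • (x + y) ∈ f.domain := by rw [smul_add]; exact add_mem hx hy
    rw [smul_add, hψ x a hx, hψ y a hy, hψ (x + y) a hxy, ← f.map_add]
    exact congrArg f (Subtype.ext (smul_add _ x y))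
  · refine eq_of_forall_op_smul_eq hN.torsion_eq_bot (hf (c • x)) fun a ha => ?_
    have hcx : op a • c • x ∈ f.domain := ha
    have hcx' : op (unop c * a) • x ∈ f.domain := by rwa [op_mul, op_unop, mul_smul]
    calc op a • ψ (c • x) = f ⟨_, hcx⟩ := hψ _ a hcx
      _ = f ⟨_, hcx'⟩ := congrArg f (Subtype.ext (mul_smul (op a) c x).symm)
      _ = op (unop c * a) • ψ x := (hψ x _ hcx').symm
      _ = op a • c • ψ x := by rw [op_mul, op_unop, mul_smul]
  · refine eq_of_forall_op_smul_eq hN.torsion_eq_bot F.top_mem fun a _ => ?_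
    exact (hψ x a (f.domain.smul_mem _ x.2)).trans (f.map_smul (op a) x)

theorem IsClosedModule.exists_linearMap_comp_eq (hN : F.IsClosedModule N) {q : M →ₗ[Rᵐᵒᵖ] L}
    (hker : LinearMap.ker q ≤ F.torsion M) (hrange : F.IsDenseSubmodule (LinearMap.range q))
    (φ : M →ₗ[Rᵐᵒᵖ] N) : ∃ ψ : L →ₗ[Rᵐᵒᵖ] N, ψ ∘ₗ q = φ := by
  have hφ : LinearMap.ker q ≤ LinearMap.ker φ := fun m hm => by
    have := map_mem_torsion φ (hker hm)
    rwa [hN.torsion_eq_bot] at this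
  obtain ⟨ψ, hψ⟩ := hN.exists_linearMap_extending
    ⟨LinearMap.range q, (LinearMap.ker q).liftQ φ hφ ∘ₗ q.quotKerEquivRange.symm.toLinearMap⟩ hrange
  exact ⟨ψ, LinearMap.ext fun m => (hψ ⟨q m, m, rfl⟩).trans <|
    congrArg ((LinearMap.ker q).liftQ φ hφ) (q.quotKerEquivRange_symm_apply_image m ⟨m, rfl⟩)⟩

end ClosedModules

section DualNumbers

variable {R : Type u} [Ring R] {F : GabrielFilter R} {δ : R → R}
variable {L M N : Type*} [AddCommGroup L] [Module Rᵐᵒᵖ L] [AddCommGroup M] [Module Rᵐᵒᵖ M]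
  [AddCommGroup N] [Module Rᵐᵒᵖ N]

theorem torsion_dualNumberModule_eq_bot (hδ : IsRingDerivation δ) (hN : F.torsion N = ⊥) :
    F.torsion (DualNumberModule hδ N) = ⊥ := by
  refine (Submodule.eq_bot_iff _).2 fun p hp => ?_
  have hfst : p.fst = 0 := by
    have := map_mem_torsion (DualNumberModule.fstₗ hδ N) hp
    rwa [hN] at this
  refine DualNumberModule.ext hfst (eq_of_forall_op_smul_eq hN (mem_torsion.1 hp) fun a ha => ?_)
  have hsnd := congrArg DualNumberModule.snd (mem_rightAnn.1 ha)
  rw [DualNumberModule.snd_smul, hfst, smul_zero, add_zero] at hsnd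
  exact hsnd.trans (smul_zero _).symm

theorem IsClosedModule.dualNumberModule (hδ : IsRingDerivation δ) (hN : F.IsClosedModule N) :
    F.IsClosedModule (DualNumberModule hδ N) where
  torsion_eq_bot := torsion_dualNumberModule_eq_bot hδ hN.torsion_eq_bot
  exists_op_smul_eq f hf := by
    obtain ⟨x, hx⟩ := hN.exists_op_smul_eq ((DualNumberModule.fstₗ hδ N).compPMap f) hf
    replace hx (a : f.domain) : op (a : R) • x = (f a).fst := hx a
    -- Subtracting left multiplication by `x` from `f` leaves a linear map with values in `N ε`.
    let g : f.domain →ₗ[Rᵐᵒᵖ] N :=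
      { toFun a := (f a).snd - op (δ a) • x
        map_add' a b := by
          rw [f.map_add, DualNumberModule.snd_add, Submodule.coe_add, hδ.map_add, op_add, add_smul,
            add_sub_add_comm]
        map_smul' c a := by
          have hca : δ (c • (a : R)) = δ a * unop c + a * δ (unop c) := hδ.map_mul a (unop c)
          rw [f.map_smul, DualNumberModule.snd_smul, Submodule.coe_smul, hca, ← hx, op_add, op_mul,
            op_mul, op_unop, add_smul, mul_smul, mul_smul, add_sub_add_right_eq_sub, smul_sub,
            RingHom.id_apply] }
    obtain ⟨y, hy⟩ := hN.exists_op_smul_eq ⟨f.domain, g⟩ hf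
    exact ⟨⟨x, y⟩, fun a => DualNumberModule.ext (hx a) (eq_sub_iff_add_eq.1 (hy a))⟩

theorem _root_.IsDerivationAlong.eq_of_eqOn_range {φ : L →ₗ[Rᵐᵒᵖ] N} {D D' : L → N}
    (hD : IsDerivationAlong δ φ D) (hD' : IsDerivationAlong δ φ D') (hδ : IsRingDerivation δ)
    (hN : F.torsion N = ⊥) {q : M →ₗ[Rᵐᵒᵖ] L} (hrange : F.IsDenseSubmodule (LinearMap.range q))
    (h : ∀ m, D (q m) = D' (q m)) : D = D' := by
  have heq : hD.toDualNumberModule hδ = hD'.toDualNumberModule hδ :=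
    linearMap_ext_of_isDenseSubmodule (torsion_dualNumberModule_eq_bot hδ hN) hrange <|
      LinearMap.ext fun m => DualNumberModule.ext rfl (h m)
  exact funext fun x => congrArg DualNumberModule.snd (LinearMap.congr_fun heq x)

theorem IsClosedModule.exists_isDerivationAlong (hN : F.IsClosedModule N)
    (hδ : IsRingDerivation δ) {q : M →ₗ[Rᵐᵒᵖ] L} (hker : LinearMap.ker q ≤ F.torsion M)
    (hrange : F.IsDenseSubmodule (LinearMap.range q)) {φ : L →ₗ[Rᵐᵒᵖ] N} {d : M → N}
    (hd : IsDerivationAlong δ (φ ∘ₗ q) d) :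
    ∃ D : L → N, IsDerivationAlong δ φ D ∧ ∀ m, D (q m) = d m := by
  obtain ⟨f, hf⟩ := (hN.dualNumberModule hδ).exists_linearMap_comp_eq hker hrange
    (hd.toDualNumberModule hδ)
  have hfst : DualNumberModule.fstₗ hδ N ∘ₗ f = φ :=
    linearMap_ext_of_isDenseSubmodule hN.torsion_eq_bot hrange <| by
      rw [LinearMap.comp_assoc, hf]; rfl
  refine ⟨fun x => (f x).snd, hfst ▸ .of_linearMap f, fun m => ?_⟩
  exact congrArg DualNumberModule.snd (LinearMap.congr_fun hf m)

end DualNumbers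

section ModulesOfQuotients

variable {R : Type u} [Ring R] {F G : GabrielFilter R} {M : Type v} [AddCommGroup M]
  [Module Rᵐᵒᵖ M]

variable (F M) in
/-- The canonical map `q_M : M → M_F` as a linear map. -/
def toQuotₗ : M →ₗ[Rᵐᵒᵖ] F.Quotients M where
  toFun := F.toQuot
  map_add' := toQuot_add
  map_smul' c m := toQuot_smul (unop c) m

theorem ker_toQuotₗ : LinearMap.ker (F.toQuotₗ M) = F.torsion M :=
  Submodule.ext fun _ => toQuot_eq_zero_iff

theorem isDenseSubmodule_range_toQuotₗ : F.IsDenseSubmodule (LinearMap.range (F.toQuotₗ M)) := by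
  intro x
  obtain ⟨I, hI, h⟩ := exists_act_eq_toQuot x
  refine F.mem_of_le hI fun a ha => ?_
  obtain ⟨m, hm⟩ := h a ha
  exact ⟨m, hm.symm⟩

theorem op_smul_mk_eq_toQuot {f : F.PreQuot M} {a : R} {m : M}
    (h : Val f.1 a ((F.torsion M).mkQ m)) :
    op a • (show F.Quotients M from Quotient.mk _ f) = F.toQuot m :=
  quot_eq F.top_mem fun z _ => ⟨_, (val_toQuot F a z).pComp <| by
    rw [map_smul]
    exact h.smul (op z), val_toQuot F m z⟩

theorem torsion_quotients_eq_bot : F.torsion (F.Quotients M) = ⊥ := by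
  refine (Submodule.eq_bot_iff _).2 fun x hx => ?_
  induction x using Quotient.inductionOn with | _ f
  refine quot_eq (F.inf_mem (mem_torsion.1 hx) f.2) fun a ha => ⟨0, ?_, val_zero a⟩
  obtain ⟨m, hm⟩ := Submodule.mkQ_surjective _ (f.1 ⟨a, ha.2⟩)
  have hfa : Val f.1 a ((F.torsion M).mkQ m) := hm ▸ val_of_mem ha.2
  have hm_torsion : m ∈ F.torsion M :=
    toQuot_eq_zero_iff.1 ((op_smul_mk_eq_toQuot hfa).symm.trans (mem_rightAnn.1 ha.1))
  rwa [Submodule.mkQ_apply, (Submodule.Quotient.mk_eq_zero _).2 hm_torsion] at hfa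

theorem torsion_quotients_eq_bot_of_le (h : F ≤ G) : F.torsion (G.Quotients M) = ⊥ :=
  eq_bot_iff.2 ((torsion_mono h).trans torsion_quotients_eq_bot.le)

theorem exists_op_smul_eq_toQuot (g : R →ₗ.[Rᵐᵒᵖ] M ⧸ F.torsion M) (hg : g.domain ∈ F.sets) :
    ∃ x : F.Quotients M, ∀ (a : g.domain) (m : M), g a = (F.torsion M).mkQ m →
      op (a : R) • x = F.toQuot m :=
  ⟨Quotient.mk _ ⟨g, hg⟩, fun a _ h => op_smul_mk_eq_toQuot ⟨a.2, h⟩⟩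

theorem IsDenseSubmodule.map_comap_mem {L : Type w} [AddCommGroup L] [Module Rᵐᵒᵖ L]
    {P : Submodule Rᵐᵒᵖ L} (hP : F.IsDenseSubmodule P) {f : R →ₗ.[Rᵐᵒᵖ] L}
    (hf : f.domain ∈ F.sets) : (P.comap f.toFun).map f.domain.subtype ∈ F.sets := by
  refine F.mem_of_colon hf fun a ha => F.mem_of_le (hP (f ⟨a, ha⟩)) fun r hr => ?_
  refine ⟨op r • ⟨a, ha⟩, ?_, rfl⟩
  rw [SetLike.mem_coe, Submodule.mem_comap, map_smul]
  exact hr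

theorem isClosedModule_quotients : F.IsClosedModule (F.Quotients M) where
  torsion_eq_bot := torsion_quotients_eq_bot
  exists_op_smul_eq f hf := by
    let q := F.toQuotₗ M
    let P := (LinearMap.range q).comap f.toFun
    let e : (M ⧸ F.torsion M) ≃ₗ[Rᵐᵒᵖ] LinearMap.range q :=
      (Submodule.quotEquivOfEq _ _ ker_toQuotₗ.symm).trans q.quotKerEquivRange
    let g : R →ₗ.[Rᵐᵒᵖ] M ⧸ F.torsion M :=
      ⟨P.map f.domain.subtype, e.symm.toLinearMap ∘ₗ f.toFun.submoduleComap (LinearMap.range q) ∘ₗ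
        (Submodule.equivMapOfInjective _ f.domain.injective_subtype P).symm.toLinearMap⟩
    have hgdom : g.domain ∈ F.sets := isDenseSubmodule_range_toQuotₗ.map_comap_mem hf
    obtain ⟨x, hx⟩ := exists_op_smul_eq_toQuot g hgdom
    have hxP (a : f.domain) (ha : a ∈ P) : op (a : R) • x = f a := by
      obtain ⟨m, hm⟩ := ha
      have hga : g ⟨a, a, ⟨m, hm⟩, rfl⟩ = (F.torsion M).mkQ m := by
        refine e.symm_apply_eq.2 (Subtype.ext (Eq.trans ?_ hm.symm))
        have hae : (Submodule.equivMapOfInjective _ f.domain.injective_subtype P).symm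
            ⟨a, a, ⟨m, hm⟩, rfl⟩ = ⟨a, m, hm⟩ := (LinearEquiv.symm_apply_eq _).2 rfl
        exact congrArg (fun b : P => f b) hae
      exact (hx _ m hga).trans hm
    refine ⟨x, fun a => eq_of_forall_op_smul_eq torsion_quotients_eq_bot
      (F.colon_mem hgdom a) fun r hr => ?_⟩
    obtain ⟨b, hb, hba : (b : R) = a * r⟩ := hr
    calc op r • op (a : R) • x = op (b : R) • x := by rw [hba, op_mul, mul_smul]
      _ = f b := hxP b hb
      _ = f (op r • a) := congrArg f (Subtype.ext hba)
      _ = op r • f a := f.map_smul (op r) a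

variable (M) in
/-- The canonical map `q₁₂ : M_F → M_G` for `F ⊆ G` as a linear map. -/
def quotMapₗ (h : F ≤ G) : F.Quotients M →ₗ[Rᵐᵒᵖ] G.Quotients M where
  toFun := quotMap h
  map_add' := quotMap_add h
  map_smul' c x := quotMap_act h x (F.toQuot (unop c))

/-- Left multiplication `R_F → M_F`, `y ↦ x y`, by an element `x` of `M_F`, as a linear map. -/
noncomputable def actₗ (x : F.Quotients M) : F.Quotients R →ₗ[Rᵐᵒᵖ] F.Quotients M where
  toFun := act x
  map_add' := act_add x
  map_smul' c y := (act_assoc x y (F.toQuot (unop c))).symm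

end ModulesOfQuotients

section Extensions

variable {R : Type u} [Ring R] {F G : GabrielFilter R} {δ : R → R} {M : Type v} [AddCommGroup M]
  [Module Rᵐᵒᵖ M] {d : M → M}

theorem exists_isModuleExtension (F : GabrielFilter R) (hδ : IsRingDerivation δ)
    (hd : IsModuleDerivation δ d) : ∃ D, F.IsModuleExtension δ d D := by
  have hqd : IsDerivationAlong δ (LinearMap.id ∘ₗ F.toQuotₗ M) (F.toQuotₗ M ∘ d) :=
    (isDerivationAlong_id_iff.2 hd).linearMap_comp (F.toQuotₗ M)
  obtain ⟨D, hD, hDq⟩ := isClosedModule_quotients.exists_isDerivationAlong hδ ker_toQuotₗ.le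
    isDenseSubmodule_range_toQuotₗ hqd
  exact ⟨D, isDerivationAlong_id_iff.1 hD, hDq⟩

theorem IsModuleExtension.quotMap_apply (h : F ≤ G) (hδ : IsRingDerivation δ)
    {D₁ : F.Quotients M → F.Quotients M} {D₂ : G.Quotients M → G.Quotients M}
    (hD₁ : F.IsModuleExtension δ d D₁) (hD₂ : G.IsModuleExtension δ d D₂) (x : F.Quotients M) :
    quotMap h (D₁ x) = D₂ (quotMap h x) := by
  have h₁ : IsDerivationAlong δ (quotMapₗ M h) (quotMapₗ M h ∘ D₁) :=
    (isDerivationAlong_id_iff.2 hD₁.isModuleDerivation).linearMap_comp (quotMapₗ M h)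
  have h₂ : IsDerivationAlong δ (quotMapₗ M h) (D₂ ∘ quotMapₗ M h) :=
    (isDerivationAlong_id_iff.2 hD₂.isModuleDerivation).comp_linearMap (quotMapₗ M h)
  refine congrFun (h₁.eq_of_eqOn_range h₂ hδ (torsion_quotients_eq_bot_of_le h)
    isDenseSubmodule_range_toQuotₗ fun m => ?_) x
  exact (congrArg (quotMap h) (hD₁.apply_toQuot m)).trans (hD₂.apply_toQuot m).symm

theorem IsModuleExtension.unique (hδ : IsRingDerivation δ) {D D' : F.Quotients M → F.Quotients M}
    (hD : F.IsModuleExtension δ d D) (hD' : F.IsModuleExtension δ d D') : D = D' := by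
  refine (isDerivationAlong_id_iff.2 hD.isModuleDerivation).eq_of_eqOn_range
    (isDerivationAlong_id_iff.2 hD'.isModuleDerivation) hδ torsion_quotients_eq_bot
    isDenseSubmodule_range_toQuotₗ fun m => ?_
  exact (hD.apply_toQuot m).trans (hD'.apply_toQuot m).symm

theorem isRingExtension_iff_isModuleExtension (hδ : IsRingDerivation δ)
    {D : F.Quotients R → F.Quotients R} :
    F.IsRingExtension δ D ↔ F.IsModuleExtension δ δ D := by
  refine ⟨fun hD => ⟨⟨hD.isRingDerivation.map_add, fun x r => ?_⟩, hD.apply_toQuot⟩,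
    fun hD => ⟨⟨hD.isModuleDerivation.map_add, fun x y => ?_⟩, hD.apply_toQuot⟩⟩
  · calc D (x * F.toQuot r) = D x * F.toQuot r + x * D (F.toQuot r) :=
          hD.isRingDerivation.map_mul ..
      _ = D x * F.toQuot r + x * F.toQuot (δ r) := by rw [hD.apply_toQuot]
  · have hD_id := isDerivationAlong_id_iff.2 hD.isModuleDerivation
    have hleft : IsDerivationAlong δ (actₗ x) fun y => D (x * y) := hD_id.comp_linearMap (actₗ x)
    have hright : IsDerivationAlong δ (actₗ x) fun y => D x * y + x * D y :=
      (hD_id.linearMap_comp (actₗ x)).linearMap_add (actₗ (D x))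
    refine congrFun (hleft.eq_of_eqOn_range hright hδ torsion_quotients_eq_bot
      (isDenseSubmodule_range_toQuotₗ (M := R)) fun r => ?_) y
    calc D (x * F.toQuot r) = D x * F.toQuot r + x * F.toQuot (δ r) :=
          hD.isModuleDerivation.map_smul x r
      _ = D x * F.toQuot r + x * D (F.toQuot r) := by rw [hD.apply_toQuot]

theorem moduleExtensionsAgree_of_le (h : F ≤ G) (hδ : IsRingDerivation δ)
    (hd : IsModuleDerivation δ d) : F.ModuleExtensionsAgree G δ d := by
  obtain ⟨D₁, hD₁⟩ := F.exists_isModuleExtension hδ hd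
  obtain ⟨D₂, hD₂⟩ := G.exists_isModuleExtension hδ hd
  exact ⟨h, D₁, D₂, ⟨hD₁, fun _ hD => hD.unique hδ hD₁⟩, ⟨hD₂, fun _ hD => hD.unique hδ hD₂⟩,
    hD₁.quotMap_apply h hδ hD₂⟩

theorem ringExtensionsAgree_of_le (h : F ≤ G) (hδ : IsRingDerivation δ) :
    F.RingExtensionsAgree G δ := by
  simpa only [RingExtensionsAgree, isRingExtension_iff_isModuleExtension hδ,
    ModuleExtensionsAgree] using
    moduleExtensionsAgree_of_le h hδ hδ.isModuleDerivation

end Extensions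

section Comparisons

variable {R : Type u} [Ring R]

theorem IsDenseIdeal.isEssentialIdeal {I : Submodule Rᵐᵒᵖ R} (hI : IsDenseIdeal I) :
    IsEssentialIdeal I := by
  intro J hJ
  obtain ⟨b, hb, hb0⟩ := (Submodule.ne_bot_iff _).1 hJ
  obtain ⟨r, hr, hbr⟩ := hI b b hb0
  exact (Submodule.ne_bot_iff _).2 ⟨b * r, ⟨hr, rightIdeal_mul_mem hb r⟩, hbr⟩

theorem lambek_le_goldie : lambek R ≤ goldie R := fun _ hI _ hF =>
  hF _ (IsDenseIdeal.isEssentialIdeal hI)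

theorem IsFaithful.le_lambek {F : GabrielFilter R} (hF : F.IsFaithful) : F ≤ lambek R :=
  (isGreatest_lambek R).2 hF

theorem isFaithful_classical (hR : IsRightOre R) : (classical R).IsFaithful := by
  refine (Submodule.eq_bot_iff _).2 fun r hr => ?_
  obtain ⟨t, ht, hrt⟩ := (mem_classical_torsion_iff R hR).1 hr
  exact (mul_right_mem_nonZeroDivisors_eq_zero_iff ht).1 hrt

theorem exists_toQuot_mul_eq_one {F : GabrielFilter R} {t : R}
    (ht : Function.Injective (leftMulMap t : R →ₗ[Rᵐᵒᵖ] R))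
    (htF : LinearMap.range (leftMulMap t : R →ₗ[Rᵐᵒᵖ] R) ∈ F.sets) :
    ∃ z : F.Quotients R, F.toQuot t * z = 1 := by
  let e := LinearEquiv.ofInjective (leftMulMap t : R →ₗ[Rᵐᵒᵖ] R) ht
  obtain ⟨z, hz⟩ := isClosedModule_quotients.exists_op_smul_eq
    ⟨LinearMap.range (leftMulMap t : R →ₗ[Rᵐᵒᵖ] R), F.toQuotₗ R ∘ₗ e.symm.toLinearMap⟩ htF
  have hzt (r : R) : z * F.toQuot (t * r) = F.toQuot r :=
    (hz (e r)).trans (congrArg F.toQuot (e.symm_apply_apply r))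
  refine ⟨z, eq_of_forall_op_smul_eq torsion_quotients_eq_bot htF ?_⟩
  rintro _ ⟨r, rfl⟩
  calc F.toQuot t * z * F.toQuot (t * r) = F.toQuot t * F.toQuot r := by rw [mul_assoc, hzt]
    _ = 1 * F.toQuot (t * r) := by rw [one_mul, toQuot_mul]

theorem isPerfect_classical (hR : IsRightOre R) : (classical R).IsPerfect := by
  refine isPerfect_of_one_mem_extend fun I hI => ?_
  obtain ⟨t, ht, htI⟩ := hI 1
  rw [one_mul] at htI
  obtain ⟨z, hz⟩ := exists_toQuot_mul_eq_one (F := classical R) (t := t)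
    (fun _ _ => (mul_cancel_left_mem_nonZeroDivisors ht).1) fun a => by
      obtain ⟨t', ht', r', h⟩ := hR a t ht
      exact ⟨t', ht', r', h.symm⟩
  exact hz ▸ rightIdeal_mul_mem (toQuot_mem_extend htI) z

theorem classical_le_total (hR : IsRightOre R) : classical R ≤ total R :=
  (isGreatest_total R).2 ⟨isFaithful_classical hR, isPerfect_classical hR⟩

theorem total_le_lambek : total R ≤ lambek R := (isGreatest_total R).1.1.le_lambek

end Comparisons

end GabrielFilter

theorem mainTheorem7 {R : Type u} [Ring R] {δ : R → R} (hδ : IsRingDerivation δ)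
    {M : Type v} [AddCommGroup M] [Module Rᵐᵒᵖ M] {d : M → M} (hd : IsModuleDerivation δ d) :
    ((∀ F : GabrielFilter R, F.IsFaithful →
        F.RingExtensionsAgree (GabrielFilter.lambek R) δ) ∧
      (GabrielFilter.total R).RingExtensionsAgree (GabrielFilter.lambek R) δ) ∧
    ((∀ F : GabrielFilter R, F.IsDifferential → F.IsFaithful →
        F.ModuleExtensionsAgree (GabrielFilter.lambek R) δ d) ∧
      (GabrielFilter.total R).ModuleExtensionsAgree (GabrielFilter.lambek R) δ d) ∧
    (GabrielFilter.IsRightOre R →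
      (GabrielFilter.classical R).RingExtensionsAgree (GabrielFilter.lambek R) δ ∧
      (GabrielFilter.classical R).RingExtensionsAgree (GabrielFilter.total R) δ) ∧
    ((GabrielFilter.lambek R).RingExtensionsAgree (GabrielFilter.goldie R) δ ∧
      ∀ F : GabrielFilter R, F.IsFaithful →
        F.RingExtensionsAgree (GabrielFilter.goldie R) δ) := by
  open GabrielFilter in
  exact ⟨⟨fun F hF => ringExtensionsAgree_of_le hF.le_lambek hδ,
      ringExtensionsAgree_of_le total_le_lambek hδ⟩,
    ⟨fun F _ hF => moduleExtensionsAgree_of_le hF.le_lambek hδ hd,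
      moduleExtensionsAgree_of_le total_le_lambek hδ hd⟩,
    fun hR => ⟨ringExtensionsAgree_of_le ((classical_le_total hR).trans total_le_lambek) hδ,
      ringExtensionsAgree_of_le (classical_le_total hR) hδ⟩,
    ringExtensionsAgree_of_le lambek_le_goldie hδ,
    fun F hF => ringExtensionsAgree_of_le (hF.le_lambek.trans lambek_le_goldie) hδ⟩
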